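/- Call a Borel measure $\mu$ on $\mathbb{R}^2$ a measure satisfying a power law with exponent $\beta>0$ if there are $b_1,b_2>0$ such that $b_1r^\beta\le\mu(B(x,r))\le b_2r^\beta$ for all $x\in\mathrm{supp}(\mu)$ and all $0<r<1$. Let $\mathbf{BA}$ be the set of badly approximable numbers, that is, of $x\in\mathbb{R}$ for which there is $c>0$ with $q|qx-p|>c$ for all $p\in\mathbb{Z}$, $q\in\mathbb{N}=\{1,2,\dots\}$. For $0<i\le 1$ let $$\mathbf{BA}(i)=\{x\in\mathbb{R}:\exists c>0\ \forall p\in\mathbb{Z},\,q\in\mathbb{N}\quad q^{1/i}|qx-p|>c\},$$ and $\mathbf{BA}(0)=\mathbb{R}$. For $i,j>0$ with $i+j=1$ let $$\mathbf{BA}(i,j)=\{(x,y)\in\mathbb{R}^2:\exists c>0\ \forall p_1,p_2\in\mathbb{Z},\,q\in\mathbb{N}\quad \max\{q|qx-p_1|^{1/i},\,q|qy-p_2|^{1/j}\}>c\},$$ and let $\mathbf{BA}(1,0)=\mathbf{BA}\times\mathbb{R}$, $\mathbf{BA}(0,1)=\mathbb{R}\times\mathbf{BA}$. Theorem. Let $i,j\in[0,1]$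 with $i+j=1$, let $\theta\in\mathbf{BA}(i)$, and let $\Theta=\{\theta\}\times[0,1]$. Let $C\subseteq\Theta$ be the support of a probability measure on $\Theta$ which satisfies a power law with exponent $\beta$. Then for every $\beta'<\beta$ there is a probability measure $\nu$ satisfying a power law with some exponent bigger than $\beta'$ such that $\mathrm{supp}(\nu)\subseteq\mathbf{BA}(i,j)\cap C$. In particular, the Hausdorff dimension of $\mathbf{BA}(i,j)\cap C$ equals $\beta$. -/

import Mathlib

open MeasureTheory

/-- The classical set of badly approximable numbers:
`x` such that for some `c > 0`, `q * |q x - p| > c` for all integers `p` and all `q ≥ 1`. -/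
def badNumbers : Set ℝ :=
  {x | ∃ c : ℝ, 0 < c ∧ ∀ (p : ℤ) (q : ℕ), 1 ≤ q → c < (q : ℝ) * |(q : ℝ) * x - (p : ℝ)|}

open Classical in
/-- The set `BA(i)` of badly approximable numbers with weight `i`, with the convention
`BA(0) = ℝ`. -/
noncomputable def badWeight (i : ℝ) : Set ℝ :=
  if i = 0 then Set.univ
  else {x | ∃ c : ℝ, 0 < c ∧ ∀ (p : ℤ) (q : ℕ), 1 ≤ q →
    c < (q : ℝ) ^ (1 / i) * |(q : ℝ) * x - (p : ℝ)|}

open Classical in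
/-- The set `BA(i, j)` of badly approximable vectors of the plane with weights `(i, j)`, with the
conventions `BA(1, 0) = BA × ℝ` and `BA(0, 1) = ℝ × BA`. -/
noncomputable def badPair (i j : ℝ) : Set (ℝ × ℝ) :=
  if j = 0 then badNumbers ×ˢ Set.univ
  else if i = 0 then Set.univ ×ˢ badNumbers
  else {v | ∃ c : ℝ, 0 < c ∧ ∀ (p₁ p₂ : ℤ) (q : ℕ), 1 ≤ q →
    c < max ((q : ℝ) * |(q : ℝ) * v.1 - (p₁ : ℝ)| ^ (1 / i))
      ((q : ℝ) * |(q : ℝ) * v.2 - (p₂ : ℝ)| ^ (1 / j))}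

/-- The measure `μ` satisfies a power law with exponent `β`: there are `b₁, b₂ > 0` with
`b₁ r ^ β ≤ μ (B(x, r)) ≤ b₂ r ^ β` for all `x` in the support of `μ` and all `0 < r < 1`. -/
def PowerLaw {X : Type*} [MetricSpace X] [MeasurableSpace X] [BorelSpace X]
    (μ : Measure X) (β : ℝ) : Prop :=
  0 < β ∧ ∃ b₁ b₂ : ℝ, 0 < b₁ ∧ 0 < b₂ ∧ ∀ x ∈ μ.support, ∀ r : ℝ, 0 < r → r < 1 →
    ENNReal.ofReal (b₁ * r ^ β) ≤ μ (Metric.closedBall x r) ∧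
      μ (Metric.closedBall x r) ≤ ENNReal.ofReal (b₂ * r ^ β)

/-- The vertical unit segment `{θ} × [0, 1]` in the plane. -/
def verticalSegment (θ : ℝ) : Set (ℝ × ℝ) := {θ} ×ˢ Set.Icc (0 : ℝ) 1

/-!
The proof constructs a tree of nested balls centred on `C` and removes from it the neighbourhoods
of all rational points that prevent approximation from being bad.

*From trees to measures.* A tree in which each node has exactly `M` children, and whose balls of
level `n` have radius `R ^ (-n) / 2` and are well separated, carries a natural measure giving mass
`M ^ (-n)` to each node of level `n`. It satisfies a power law with exponent `log M / log R`
(`exists_powerLaw_of_tree`). The power law of `μ` provides at least a constant times `R ^ β`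
separated children for every node, so a bounded number of children per node can be sacrificed
while the exponent stays above `β'`, if `R` is large.

*Pruning.* The obstacles are sorted by level (their size in units of `R`) and by depth. Suppose
that, for a node of level `n` avoiding all the obstacles of level at most `n` and for each depth
`k`, the obstacles of level `n + k + 1` and depth `k` that meet the node lie in a single ball of
radius comparable to `R ^ (-(n + k + 1))` (`SparseObstacles`). Each node then creates one pending
ball per depth, to be avoided `k + 1` levels later. Weighting a pending ball by `2 ^ (-m)`, with
`m` the remaining waiting time, keeps the total weight bounded. A child of weight at least `1` is
discarded, and there are at most four of these
(`PrunedNode.Admissible.exists_children`, `exists_powerLaw_avoiding`).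

*Rational points.* For `i, j > 0`, the dangerous rational points `(p / q, r / q)` are those with
`|q θ - p| ≤ c q ^ (-i)`. Each lies on a line `A x + B y + C = 0` with `|A| ≤ q ^ i` and
`|B| ≤ q ^ j` by the pigeonhole principle. The line is not vertical since `θ ∈ BA(i)`, and the
points of the vertical line that are close to the rational point are within `2 c / (q |B|)` of
the crossing of the two lines. The level is the logarithm of `q |B| / c`, the depth that of
`q ^ j / |B|` (both are discretized). For depth `0`, an integrality argument puts all the dangerous
points met by a node on the line of the one with the least denominator
(`AttachedLine.mem_line_of_depth_eq_zero`). For positive depth, two different lines would meet in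
a rational point of so small a level that the node would already have been removed
(`AttachedLine.crossing_eq_of_depth_pos`). The case `i = 0` uses the classical separation of
rational numbers, and the case `j = 0` is immediate with `ν = μ`.

*Dimension.* The support of a measure satisfying a power law with exponent `β` has dimension `β`:
the lower bound is the mass distribution principle, the upper bound comes from counting separated
points. Applied to `μ` and to the measures `ν`, this gives the dimension of `BA(i, j) ∩ C`.
-/

/-! ### Measures on trees of nested balls -/

/-- The radius of the balls at level `n` of the tree construction with ratio `R`. -/
noncomputable def treeRadius (R : ℝ) (n : ℕ) : ℝ := R⁻¹ ^ n / 2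

section TreeRadius
variable {R : ℝ}

lemma treeRadius_pos (hR : 2 ≤ R) (n : ℕ) : 0 < treeRadius R n := by
  unfold treeRadius; positivity

lemma treeRadius_zero : treeRadius R 0 = 1 / 2 := by simp [treeRadius]

lemma treeRadius_eq_mul_succ (hR : 2 ≤ R) (n : ℕ) :
    treeRadius R n = R * treeRadius R (n + 1) := by
  unfold treeRadius
  rw [pow_succ]
  field_simp

lemma treeRadius_succ_le (hR : 2 ≤ R) (n : ℕ) :
    treeRadius R (n + 1) ≤ treeRadius R n / 2 := by
  have := treeRadius_eq_mul_succ hR n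
  nlinarith [treeRadius_pos hR (n + 1)]

lemma treeRadius_antitone (hR : 2 ≤ R) : Antitone (treeRadius R) :=
  antitone_nat_of_succ_le fun n => by
    linarith [treeRadius_succ_le hR n, treeRadius_pos hR n]

lemma tendsto_treeRadius (hR : 2 ≤ R) :
    Filter.Tendsto (treeRadius R) Filter.atTop (nhds 0) := by
  have : Filter.Tendsto (fun n : ℕ => R⁻¹ ^ n / 2) Filter.atTop (nhds (0 / 2)) :=
    (tendsto_pow_atTop_nhds_zero_of_lt_one (by positivity)
      (inv_lt_one_of_one_lt₀ (by linarith))).div_const 2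
  rw [zero_div] at this
  exact this

lemma two_mul_treeRadius_rpow (hR : 2 ≤ R) {M : ℕ} (hM : 2 ≤ M) (n : ℕ) :
    (2 * treeRadius R n) ^ (Real.log M / Real.log R) = ((M : ℝ)⁻¹) ^ n := by
  have hM' : (0 : ℝ) < M := by positivity
  have hlog : Real.log R ≠ 0 := (Real.log_pos (by linarith)).ne'
  have h1 : R ^ (Real.log M / Real.log R) = M := by
    rw [Real.rpow_def_of_pos (by linarith), mul_div_cancel₀ _ hlog, Real.exp_log hM']
  rw [treeRadius, mul_div_cancel₀ _ two_ne_zero, ← Real.rpow_natCast,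
    ← Real.rpow_mul (by positivity), mul_comm, Real.rpow_mul (by positivity),
    Real.inv_rpow (by positivity), h1, Real.rpow_natCast]

/-- Every radius in `(0, treeRadius R 0)` lies between two consecutive tree radii. -/
lemma exists_treeRadius_near (hR : 2 ≤ R) {r : ℝ} (h0 : 0 < r) (h : r < treeRadius R 0) :
    ∃ n, treeRadius R (n + 1) ≤ r ∧ r < treeRadius R n := by
  classical
  have hex : ∃ n, treeRadius R n ≤ r := by
    have := (tendsto_treeRadius hR).eventually (gt_mem_nhds h0)
    obtain ⟨n, hn⟩ := this.exists
    exact ⟨n, hn.le⟩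
  obtain ⟨n, hn⟩ : ∃ n, Nat.find hex = n + 1 := by
    refine Nat.exists_eq_succ_of_ne_zero fun h' => ?_
    have := Nat.find_spec hex
    rw [h'] at this
    linarith
  refine ⟨n, hn ▸ Nat.find_spec hex, ?_⟩
  exact not_le.1 (Nat.find_min hex (by omega))

end TreeRadius

section Coding

variable {S : ℕ → Type*} {M : ℕ}

/-- The node of level `n` reached from the root by following the branch `ω`. -/
def branchNode (root : S 0) (child : ∀ n, S n → Fin M → S (n + 1)) (ω : ℕ → Fin M) : ∀ n, S n
  | 0 => root
  | n + 1 => child n (branchNode root child ω n) (ω n)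

lemma branchNode_congr (root : S 0) (child : ∀ n, S n → Fin M → S (n + 1)) {ω ω' : ℕ → Fin M}
    {n : ℕ} (h : ∀ m < n, ω m = ω' m) : branchNode root child ω n = branchNode root child ω' n := by
  induction n with
  | zero => rfl
  | succ n ih =>
    simp only [branchNode]
    rw [ih fun m hm => h m (by omega), h n (by omega)]

/-- The uniform Bernoulli measure on `ℕ → Fin M` gives mass `M⁻¹ ^ n` to cylinders of length `n`. -/
lemma exists_measure_cylinder (hM : 2 ≤ M) :
    ∃ P : Measure (ℕ → Fin M), IsProbabilityMeasure P ∧ ∀ (ω : ℕ → Fin M) (n : ℕ),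
      P {ω' | ∀ m < n, ω' m = ω m} = ENNReal.ofReal ((M : ℝ)⁻¹ ^ n) := by
  have : NeZero M := ⟨by omega⟩
  let u : Measure (Fin M) := (PMF.uniformOfFintype (Fin M)).toMeasure
  refine ⟨Measure.infinitePi fun _ => u, inferInstance, fun ω n => ?_⟩
  have h : {ω' : ℕ → Fin M | ∀ m < n, ω' m = ω m} =
      Set.pi (Finset.range n : Finset ℕ) fun m => {ω m} := by
    ext; simp [Set.mem_pi]
  rw [h, Measure.infinitePi_pi _ (fun _ _ => measurableSet_singleton _)]
  have hu : ∀ a : Fin M, u {a} = ENNReal.ofReal ((M : ℝ)⁻¹) := fun a => by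
    rw [PMF.toMeasure_apply_singleton _ _ (measurableSet_singleton _)]
    rw [ENNReal.ofReal_inv_of_pos (by positivity)]
    simp
  simp only [hu, Finset.prod_const, Finset.card_range]
  rw [ENNReal.ofReal_pow (by positivity)]

end Coding

/-- A tree of points with exactly `M` children at each node, whose nodes of level `n` carry balls
of radius `treeRadius R n` that are nested and well separated, supports a probability measure
which satisfies a power law with exponent `log M / log R`. -/
theorem exists_powerLaw_of_tree {X : Type*} [MetricSpace X] [MeasurableSpace X] [BorelSpace X]
    [CompleteSpace X] [SecondCountableTopology X] {S : ℕ → Type*} {M : ℕ} {R : ℝ} (hR : 2 ≤ R)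
    (hM : 2 ≤ M) (pos : ∀ n, S n → X) (root : S 0) (child : ∀ n, S n → Fin M → S (n + 1))
    (hnest : ∀ n s a, dist (pos (n + 1) (child n s a)) (pos n s) ≤ treeRadius R n / 2)
    (hsep : ∀ n s a b, a ≠ b →
      12 * treeRadius R (n + 1) < dist (pos (n + 1) (child n s a)) (pos (n + 1) (child n s b))) :
    ∃ ν : Measure X, IsProbabilityMeasure ν ∧ PowerLaw ν (Real.log M / Real.log R) ∧
      ∀ x ∈ ν.support, ∀ n, ∃ s : S n, dist x (pos n s) ≤ treeRadius R n := by
  classical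
  obtain ⟨P, hP, hcyl⟩ := exists_measure_cylinder hM
  let node := branchNode root child
  have hballs : ∀ ω n m, dist (pos (n + m) (node ω (n + m))) (pos n (node ω n)) ≤
      treeRadius R n - treeRadius R (n + m) := by
    intro ω n m
    induction m with
    | zero => simp
    | succ m ih =>
      have h1 := hnest (n + m) (node ω (n + m)) (ω (n + m))
      have h2 := treeRadius_succ_le hR (n + m)
      have h3 := dist_triangle (pos (n + (m + 1)) (node ω (n + (m + 1))))
        (pos (n + m) (node ω (n + m))) (pos n (node ω n))
      have h4 : node ω (n + (m + 1)) = child (n + m) (node ω (n + m)) (ω (n + m)) := rfl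
      rw [h4] at h3 ⊢
      change dist (pos (n + m + 1) _) _ ≤ _
      change _ ≤ treeRadius R n - treeRadius R (n + m + 1)
      change dist (pos (n + m + 1) _) _ ≤ dist (pos (n + m + 1) _) _ + _ at h3
      linarith
  have hlim : ∀ ω, ∃ x, ∀ n, dist x (pos n (node ω n)) ≤ treeRadius R n := by
    intro ω
    have hc : CauchySeq fun n => pos n (node ω n) := by
      refine cauchySeq_of_le_tendsto_0 (fun n => 2 * treeRadius R n) (fun a b N ha hb => ?_) ?_
      · obtain ⟨a, rfl⟩ := Nat.exists_eq_add_of_le ha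
        obtain ⟨b, rfl⟩ := Nat.exists_eq_add_of_le hb
        have := dist_triangle_right (pos _ (node ω (N + a))) (pos _ (node ω (N + b)))
          (pos N (node ω N))
        linarith [hballs ω N a, hballs ω N b, treeRadius_pos hR (N + a),
          treeRadius_pos hR (N + b)]
      · simpa using (tendsto_treeRadius hR).const_mul 2
    obtain ⟨x, hx⟩ := cauchySeq_tendsto_of_complete hc
    refine ⟨x, fun n => ?_⟩
    refine le_of_tendsto (hx.dist tendsto_const_nhds) ?_
    filter_upwards [Filter.eventually_ge_atTop n] with k hk
    obtain ⟨m, rfl⟩ := Nat.exists_eq_add_of_le hk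
    linarith [hballs ω n m, treeRadius_pos hR (n + m)]
  choose code hcode using hlim
  -- branches which agree up to level `n` have codes within `2 * treeRadius R n`, and conversely
  -- codes within `10 * treeRadius R n` come from such branches, because of the separation
  have hclose : ∀ ω ω' n, (∀ m < n, ω' m = ω m) → dist (code ω') (code ω) ≤ 2 * treeRadius R n := by
    intro ω ω' n h
    have h1 := hcode ω' n
    rw [show node ω' n = node ω n from branchNode_congr _ _ h] at h1
    linarith [hcode ω n, dist_triangle_right (code ω') (code ω) (pos n (node ω n))]
  have hfar : ∀ ω ω' n, dist (code ω') (code ω) ≤ 10 * treeRadius R n → ∀ m < n, ω' m = ω m := by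
    intro ω ω' n hd m
    induction m using Nat.strong_induction_on with
    | _ m ih =>
    intro hm
    by_contra hne
    have h1 := hsep m (node ω m) (ω' m) (ω m) hne
    have h2 : node ω' (m + 1) = child m (node ω m) (ω' m) := by
      change child m (node ω' m) _ = _
      rw [show node ω' m = node ω m from branchNode_congr _ _ fun l hl => ih l hl (by omega)]
    have h3 := hcode ω' (m + 1)
    rw [h2] at h3
    have h4 : dist (code ω) (pos (m + 1) (child m (node ω m) (ω m))) ≤ _ := hcode ω (m + 1)
    have h5 := dist_triangle4 (pos (m + 1) (child m (node ω m) (ω' m))) (code ω') (code ω)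
      (pos (m + 1) (child m (node ω m) (ω m)))
    rw [dist_comm _ (code ω')] at h5
    have h6 := treeRadius_antitone hR (show m + 1 ≤ n from hm)
    linarith
  have hcont : Continuous code := by
    refine continuous_iff_continuousAt.2 fun ω => Metric.tendsto_nhds.2 fun ε hε => ?_
    obtain ⟨n, hn⟩ := ((tendsto_treeRadius hR).eventually (gt_mem_nhds (half_pos hε))).exists
    have h1 : {ω' : ℕ → Fin M | ∀ m < n, ω' m = ω m} ∈ nhds ω := by
      have : {ω' : ℕ → Fin M | ∀ m < n, ω' m = ω m} =
          Set.pi (Finset.range n : Finset ℕ) fun m => {ω m} := by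
        ext; simp [Set.mem_pi]
      rw [this]
      exact set_pi_mem_nhds (Finset.finite_toSet _) fun m _ => by simp
    filter_upwards [h1] with ω' hω'
    linarith [hclose ω ω' n hω']
  have hmeas : Measurable code := hcont.measurable
  have hν : IsProbabilityMeasure (P.map code) := Measure.isProbabilityMeasure_map hmeas.aemeasurable
  have hsupp : (P.map code).support ⊆ Set.range code := by
    refine Measure.support_subset_of_isClosed (isCompact_range hcont).isClosed ?_
    rw [mem_ae_iff, Measure.map_apply hmeas (isCompact_range hcont).isClosed.measurableSet.compl]
    simp
  have hball : ∀ x r, P.map code (Metric.closedBall x r) = P {ω' | dist (code ω') x ≤ r} := by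
    intro x r
    rw [Measure.map_apply hmeas measurableSet_closedBall]
    rfl
  refine ⟨P.map code, hν, ?_, ?_⟩
  · have hlM : 0 < Real.log M := Real.log_pos (by exact_mod_cast hM)
    have hlR : 0 < Real.log R := Real.log_pos (by linarith)
    have hγ : 0 < Real.log M / Real.log R := div_pos hlM hlR
    set γ := Real.log M / Real.log R with hγdef
    have hR0 : 0 < R := by linarith
    refine ⟨hγ, (R⁻¹) ^ γ, (2 * R) ^ γ, by positivity, by positivity, ?_⟩
    intro x hx r hr0 hr1
    obtain ⟨ω, rfl⟩ := hsupp hx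
    rw [hball]
    constructor
    · -- the ball contains the cylinder of the first length `n` with `2 * treeRadius R n ≤ r`
      obtain ⟨n, hn1, hn2⟩ := exists_treeRadius_near hR (r := r / 2) (by positivity)
        (by rw [treeRadius_zero]; linarith)
      calc ENNReal.ofReal (R⁻¹ ^ γ * r ^ γ)
          ≤ ENNReal.ofReal ((M : ℝ)⁻¹ ^ (n + 1)) := by
            apply ENNReal.ofReal_le_ofReal
            rw [← two_mul_treeRadius_rpow hR hM, ← hγdef,
              ← Real.mul_rpow (by positivity) (by positivity)]
            apply Real.rpow_le_rpow (by positivity) _ hγ.le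
            rw [inv_mul_le_iff₀ hR0]
            linarith [treeRadius_eq_mul_succ hR n]
        _ = P {ω' | ∀ m < n + 1, ω' m = ω m} := (hcyl ω (n + 1)).symm
        _ ≤ _ := measure_mono fun ω' h => by
            have := hclose ω ω' _ h
            simp only [Set.mem_ofPred_eq]
            linarith
    · -- the ball meets a single cylinder of the last length `n` with `r < treeRadius R n`
      rcases lt_or_ge r (treeRadius R 0) with h | h
      · obtain ⟨n, hn1, hn2⟩ := exists_treeRadius_near hR hr0 h
        calc _ ≤ P {ω' | ∀ m < n, ω' m = ω m} := measure_mono fun ω' h' => by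
              refine hfar ω ω' n ?_
              simp only [Set.mem_ofPred_eq] at h'
              linarith
          _ = ENNReal.ofReal ((M : ℝ)⁻¹ ^ n) := hcyl ω n
          _ ≤ _ := by
            apply ENNReal.ofReal_le_ofReal
            rw [← two_mul_treeRadius_rpow hR hM, ← hγdef,
              ← Real.mul_rpow (by positivity) (by positivity)]
            apply Real.rpow_le_rpow (by linarith [treeRadius_pos hR n]) _ hγ.le
            nlinarith [treeRadius_eq_mul_succ hR n]
      · refine prob_le_one.trans ?_
        rw [← ENNReal.ofReal_one]
        apply ENNReal.ofReal_le_ofReal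
        rw [← Real.mul_rpow (by positivity) (by positivity)]
        apply Real.one_le_rpow _ hγ.le
        rw [treeRadius_zero] at h
        nlinarith
  · intro x hx n
    obtain ⟨ω, rfl⟩ := hsupp hx
    exact ⟨node ω n, hcode ω n⟩

/-! ### Pruning a tree so as to avoid sparse obstacles -/

/-- In the support of a measure satisfying a power law, the ball of radius `a` around a point of
the support contains many `δ`-separated points of the support. -/
lemma exists_separated_finset {X : Type*} [MetricSpace X] [MeasurableSpace X] [BorelSpace X]
    [SecondCountableTopology X] {μ : Measure X} {β b₁ b₂ : ℝ} (hb₂ : 0 < b₂)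
    (hμ : ∀ x ∈ μ.support, ∀ r : ℝ, 0 < r → r < 1 →
      ENNReal.ofReal (b₁ * r ^ β) ≤ μ (Metric.closedBall x r) ∧
        μ (Metric.closedBall x r) ≤ ENNReal.ofReal (b₂ * r ^ β))
    {x : X} (hx : x ∈ μ.support) {a δ : ℝ} (ha : 0 < a) (ha1 : a < 1) (hδ : 0 < δ) (hδ1 : δ < 1)
    (m : ℕ) (hm : m * (b₂ * δ ^ β) ≤ b₁ * a ^ β) :
    ∃ t : Finset X, t.card = m ∧ (∀ y ∈ t, y ∈ μ.support ∧ dist y x ≤ a) ∧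
      ∀ y ∈ t, ∀ z ∈ t, y ≠ z → δ < dist y z := by
  classical
  induction m with
  | zero => exact ⟨∅, by simp⟩
  | succ m ih =>
    have hc : 0 < b₂ * δ ^ β := by positivity
    push_cast at hm
    obtain ⟨t, ht, hts, htd⟩ := ih (by nlinarith)
    -- the balls of radius `δ` around the points of `t` have too little mass to cover
    obtain ⟨y, hy, hyx, hyt⟩ : ∃ y ∈ μ.support, dist y x ≤ a ∧ ∀ z ∈ t, δ < dist y z := by
      by_contra! hcon
      have hcov : μ (Metric.closedBall x a) ≤ μ (⋃ z ∈ t, Metric.closedBall z δ) := by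
        refine measure_mono_ae ?_
        filter_upwards [Measure.support_mem_ae (μ := μ)] with y hy hya
        obtain ⟨z, hz, hyz⟩ := hcon y hy hya
        exact Set.mem_iUnion₂.2 ⟨z, hz, hyz⟩
      have h1 : ENNReal.ofReal (b₁ * a ^ β) ≤ ENNReal.ofReal (m * (b₂ * δ ^ β)) :=
        calc _ ≤ _ := (hμ x hx a ha ha1).1
          _ ≤ _ := hcov
          _ ≤ ∑ z ∈ t, μ (Metric.closedBall z δ) := measure_biUnion_finset_le _ _
          _ ≤ ∑ z ∈ t, ENNReal.ofReal (b₂ * δ ^ β) :=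
            Finset.sum_le_sum fun z hz => (hμ z (hts z hz).1 δ hδ hδ1).2
          _ = _ := by
            rw [Finset.sum_const, ht, nsmul_eq_mul, ENNReal.ofReal_mul (Nat.cast_nonneg m),
              ENNReal.ofReal_natCast]
      rw [ENNReal.ofReal_le_ofReal_iff (by positivity)] at h1
      linarith
    have hyn : y ∉ t := fun h => by
      have := hyt y h
      rw [dist_self] at this
      linarith
    refine ⟨insert y t, by rw [Finset.card_insert_of_notMem hyn, ht], ?_, ?_⟩
    · intro z hz
      rcases Finset.mem_insert.1 hz with rfl | hz
      exacts [⟨hy, hyx⟩, hts z hz]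
    · intro z hz w hw hne
      rcases Finset.mem_insert.1 hz with hzy | hz <;> rcases Finset.mem_insert.1 hw with hwy | hw
      · exact absurd (hzy.trans hwy.symm) hne
      · exact hzy ▸ hyt w hw
      · exact hwy ▸ dist_comm y z ▸ hyt z hz
      · exact htd z hz w hw hne

/-- The weighted number of pending balls of level at least `N`; a ball of level `N + m` has
weight `2⁻¹ ^ m`. -/
noncomputable def pendingWeight {X : Type*} (T : ℕ → Finset X) (N : ℕ) : ENNReal :=
  ∑' m : ℕ, ((T (N + m)).card : ENNReal) * 2⁻¹ ^ m

lemma pendingWeight_eq {X : Type*} (T : ℕ → Finset X) (N : ℕ) :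
    pendingWeight T N = (T N).card + 2⁻¹ * pendingWeight T (N + 1) := by
  unfold pendingWeight
  rw [tsum_eq_zero_add' ENNReal.summable, ← ENNReal.tsum_mul_left]
  simp only [add_zero, pow_zero, mul_one]
  congr 2
  ext m
  rw [show N + 1 + m = N + (m + 1) by ring, pow_succ]
  ring

section Pruning

variable {X : Type*} [MetricSpace X]

/-- The ball of level `n` around `x` avoids all the sets of `𝒟` of level at most `n`, where the
sets in `𝒟 n' k` have level `n' + k + 1`. -/
def AvoidsUpTo (𝒟 : ℕ → ℕ → Set (Set X)) (R : ℝ) (n : ℕ) (x : X) : Prop :=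
  ∀ n' k, n' + k + 1 ≤ n → ∀ D ∈ 𝒟 n' k, Disjoint D (Metric.closedBall x (treeRadius R n))

/-- The obstacles `𝒟` are sparse along `K`: if the ball of level `n` around a point of `K` avoids
all obstacles of level at most `n`, then for each `k` all the sets in `𝒟 n k` which meet this ball
are covered by a single ball of radius `4 * treeRadius R (n + k + 1)`. -/
def SparseObstacles (𝒟 : ℕ → ℕ → Set (Set X)) (R : ℝ) (K : Set X) : Prop :=
  ∀ n k, ∀ x ∈ K, AvoidsUpTo 𝒟 R n x → ∃ p, ∀ D ∈ 𝒟 n k,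
    (D ∩ Metric.closedBall x (treeRadius R n)).Nonempty →
      D ⊆ Metric.closedBall p (4 * treeRadius R (n + k + 1))

/-- A node of the pruned tree: a point together with, for each level `N`, the finite set of centres
of the balls of radius `4 * treeRadius R N` which still have to be avoided below this point. -/
structure PrunedNode (X : Type*) where
  /-- The centre of the node. -/
  point : X
  /-- The centres of the pending balls of each level. -/
  pending : ℕ → Finset X

/-- A node is admissible at level `n` if its point lies in `K`, its ball avoids all obstacles of
level at most `n`, the pending balls cover the obstacles of higher level which were dealt with
before, and the weight of the pending balls is less than `1`. -/
structure PrunedNode.Admissible (𝒟 : ℕ → ℕ → Set (Set X)) (R : ℝ) (K : Set X) (n : ℕ)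
    (s : PrunedNode X) : Prop where
  mem : s.point ∈ K
  avoids : AvoidsUpTo 𝒟 R n s.point
  covered : ∀ n' < n, ∀ k, n < n' + k + 1 → ∀ D ∈ 𝒟 n' k,
    (D ∩ Metric.closedBall s.point (treeRadius R n)).Nonempty →
      ∃ p ∈ s.pending (n' + k + 1), D ⊆ Metric.closedBall p (4 * treeRadius R (n' + k + 1))
  weight : 2⁻¹ * pendingWeight s.pending (n + 1) < 1

open Classical in
/-- The pending balls which meet the ball of level `n` around `y`. -/
noncomputable def restrictPending (R : ℝ) (T : ℕ → Finset X) (n : ℕ) (y : X) (N : ℕ) : Finset X :=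
  (T N).filter fun p =>
    (Metric.closedBall p (4 * treeRadius R N) ∩ Metric.closedBall y (treeRadius R n)).Nonempty

/-- Pending balls of level at least `n` meet at most one of several balls of level `n` with well
separated centres. -/
lemma sum_pendingWeight_restrict_le {R : ℝ} (hR : 2 ≤ R) (T : ℕ → Finset X) (n : ℕ) (t : Finset X)
    (ht : ∀ y ∈ t, ∀ z ∈ t, y ≠ z → 12 * treeRadius R n < dist y z) :
    ∑ y ∈ t, pendingWeight (restrictPending R T n y) n ≤ pendingWeight T n := by
  classical
  unfold pendingWeight
  rw [← Summable.tsum_finsetSum fun _ _ => ENNReal.summable]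
  refine ENNReal.tsum_le_tsum fun m => ?_
  rw [← Finset.sum_mul]
  gcongr
  rw [← Nat.cast_sum]
  norm_cast
  let r : X → X → Prop := fun y p =>
    (Metric.closedBall p (4 * treeRadius R (n + m)) ∩
      Metric.closedBall y (treeRadius R n)).Nonempty
  calc _ = ∑ y ∈ t, (Finset.bipartiteAbove r (T (n + m)) y).card := by
        refine Finset.sum_congr rfl fun y _ => ?_
        unfold restrictPending Finset.bipartiteAbove
        congr
    _ = ∑ p ∈ T (n + m), (Finset.bipartiteBelow r t p).card :=
        Finset.sum_card_bipartiteAbove_eq_sum_card_bipartiteBelow r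
    _ ≤ ∑ p ∈ T (n + m), 1 := by
        refine Finset.sum_le_sum fun p _ => Finset.card_le_one.2 fun y hy z hz => ?_
        by_contra hne
        obtain ⟨hyt, u, hu1, hu2⟩ := Finset.mem_filter.1 hy
        obtain ⟨hzt, v, hv1, hv2⟩ := Finset.mem_filter.1 hz
        have h1 := ht y hyt z hzt hne
        have h2 := treeRadius_antitone hR (Nat.le_add_right n m)
        rw [Metric.mem_closedBall] at hu1 hu2 hv1 hv2
        -- otherwise the centres would be within `2 * (4 + 1)` radii
        have h3 := dist_triangle4 y u p v
        have h4 := dist_triangle y v z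
        rw [dist_comm] at hu2 hv1
        linarith [treeRadius_pos hR n]
    _ = _ := by simp

/-- The inductive step of the construction: at most four children of an admissible node have to be
discarded. -/
lemma PrunedNode.Admissible.exists_children {𝒟 : ℕ → ℕ → Set (Set X)} {R : ℝ} (hR : 2 ≤ R)
    {K : Set X} (h𝒟 : SparseObstacles 𝒟 R K) {n M : ℕ} {s : PrunedNode X}
    (hs : s.Admissible 𝒟 R K n) {t : Finset X} (htc : M + 4 ≤ t.card)
    (htK : ∀ y ∈ t, y ∈ K ∧ dist y s.point ≤ treeRadius R n / 2)
    (htd : ∀ y ∈ t, ∀ z ∈ t, y ≠ z → 12 * treeRadius R (n + 1) < dist y z) :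
    ∃ f : Fin M → PrunedNode X, (∀ a, (f a).Admissible 𝒟 R K (n + 1)) ∧
      (∀ a, dist (f a).point s.point ≤ treeRadius R n / 2) ∧
      ∀ a b, a ≠ b → 12 * treeRadius R (n + 1) < dist (f a).point (f b).point := by
  classical
  have hp := fun k => h𝒟 n k s.point hs.mem hs.avoids
  choose p hp using hp
  -- one new pending ball for each level `N ≥ n + 1`, of depth `N - (n + 1)`; the values of `T`
  -- at lower levels are irrelevant
  let T : ℕ → Finset X := fun N => insert (p (N - (n + 1))) (s.pending N)
  let Ψ : X → ENNReal := fun y => pendingWeight (restrictPending R T (n + 1) y) (n + 1)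
  have hT : pendingWeight T (n + 1) ≤ 4 :=
    calc pendingWeight T (n + 1) ≤ pendingWeight s.pending (n + 1) + ∑' m : ℕ, 2⁻¹ ^ m := by
          unfold pendingWeight
          rw [← ENNReal.tsum_add]
          refine ENNReal.tsum_le_tsum fun m => ?_
          rw [← add_one_mul]
          gcongr
          exact_mod_cast Finset.card_insert_le _ _
      _ ≤ 2 + 2 := by
          gcongr
          · have h := mul_le_mul_right hs.weight.le 2
            rwa [← mul_assoc, ENNReal.mul_inv_cancel (by norm_num) (by norm_num), one_mul,
              mul_one] at h
          · rw [ENNReal.tsum_geometric]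
            norm_num
      _ = 4 := by norm_num
  have hbad : (t.filter fun y => 1 ≤ Ψ y).card ≤ 4 := by
    have h : ((t.filter fun y => 1 ≤ Ψ y).card : ENNReal) ≤ 4 :=
      calc ((t.filter fun y => 1 ≤ Ψ y).card : ENNReal)
          = ∑ y ∈ t.filter fun y => 1 ≤ Ψ y, 1 := by simp
        _ ≤ ∑ y ∈ t.filter fun y => 1 ≤ Ψ y, Ψ y :=
            Finset.sum_le_sum fun y hy => (Finset.mem_filter.1 hy).2
        _ ≤ ∑ y ∈ t, Ψ y := Finset.sum_le_sum_of_subset (Finset.filter_subset _ _)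
        _ ≤ pendingWeight T (n + 1) := sum_pendingWeight_restrict_le hR T (n + 1) t htd
        _ ≤ 4 := hT
    exact_mod_cast h
  have hgood : M ≤ (t.filter fun y => ¬ 1 ≤ Ψ y).card := by
    have := Finset.card_filter_add_card_filter_not (s := t) (fun y => 1 ≤ Ψ y)
    omega
  obtain ⟨u, hu, huc⟩ := Finset.exists_subset_card_eq hgood
  let e := u.equivFinOfCardEq huc
  have hut : ∀ a, ((e.symm a : X)) ∈ t := fun a => Finset.filter_subset _ _ (hu (e.symm a).2)
  refine ⟨fun a => ⟨e.symm a, restrictPending R T (n + 1) (e.symm a)⟩, fun a => ?_,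
    fun a => (htK _ (hut a)).2, fun a b hab => htd _ (hut a) _ (hut b) fun h =>
      hab (e.symm.injective (Subtype.ext h))⟩
  set y : X := (e.symm a : X) with hy
  have hyΨ : Ψ y < 1 := not_le.1 (Finset.mem_filter.1 (hu (e.symm a).2)).2
  have hsub : Metric.closedBall y (treeRadius R (n + 1)) ⊆
      Metric.closedBall s.point (treeRadius R n) :=
    Metric.closedBall_subset_closedBall' (by
      linarith [(htK y (hut a)).2, treeRadius_succ_le hR n])
  -- obstacles meeting the ball of the child are covered by balls pending for the child
  have hcov : ∀ n' ≤ n, ∀ k, n < n' + k + 1 → ∀ D ∈ 𝒟 n' k,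
      (D ∩ Metric.closedBall y (treeRadius R (n + 1))).Nonempty →
      ∃ q ∈ restrictPending R T (n + 1) y (n' + k + 1),
        D ⊆ Metric.closedBall q (4 * treeRadius R (n' + k + 1)) := by
    intro n' hn' k hk D hD hDy
    have hDs := hDy.mono (Set.inter_subset_inter_right D hsub)
    obtain ⟨q, hq, hDq⟩ : ∃ q ∈ T (n' + k + 1),
        D ⊆ Metric.closedBall q (4 * treeRadius R (n' + k + 1)) := by
      rcases hn'.lt_or_eq with h | rfl
      · obtain ⟨q, hq, hDq⟩ := hs.covered n' h k hk D hD hDs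
        exact ⟨q, Finset.mem_insert_of_mem hq, hDq⟩
      · refine ⟨p k, ?_, hp k D hD hDs⟩
        have : n' + k + 1 - (n' + 1) = k := by omega
        simp only [T, this]
        exact Finset.mem_insert_self _ _
    exact ⟨q, Finset.mem_filter.2 ⟨hq, hDy.mono (Set.inter_subset_inter_left _ hDq)⟩, hDq⟩
  have hw := hyΨ
  simp only [Ψ] at hw
  rw [pendingWeight_eq] at hw
  refine ⟨(htK y (hut a)).1, ?_, fun n' hn' k hk D hD hDy => ?_, lt_of_le_of_lt le_add_self hw⟩
  · intro n' k hk D hD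
    rw [Set.disjoint_iff_inter_eq_empty]
    by_contra hne
    have hne' := Set.nonempty_iff_ne_empty.2 hne
    rcases hk.lt_or_eq with h | h
    · exact (hne'.mono (Set.inter_subset_inter_right D hsub)).ne_empty
        (Set.disjoint_iff_inter_eq_empty.1 (hs.avoids n' k (by omega) D hD))
    · obtain ⟨q, hq, -⟩ := hcov n' (by omega) k (by omega) D hD hne'
      rw [h] at hq
      have h1 : 1 ≤ (restrictPending R T (n + 1) y (n + 1)).card := Finset.card_pos.2 ⟨q, hq⟩
      have h2 := lt_of_le_of_lt le_self_add hw
      have h3 : (1 : ENNReal) ≤ (restrictPending R T (n + 1) y (n + 1)).card := by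
        exact_mod_cast h1
      exact (h3.trans_lt h2).false
  · exact hcov n' (by omega) k (by omega) D hD hDy

end Pruning

/-- The support of a measure satisfying a power law with exponent `β` contains, for each `β' < β`,
the support of a measure which avoids a given sparse family of obstacles and satisfies a power law
with exponent larger than `β'`, provided the ratio `R` of the obstacles is large. -/
theorem exists_powerLaw_avoiding {X : Type*} [MetricSpace X] [MeasurableSpace X] [BorelSpace X]
    [CompleteSpace X] [SecondCountableTopology X] {μ : Measure X} [IsProbabilityMeasure μ]
    {β : ℝ} (hμ : PowerLaw μ β) {β' : ℝ} (hβ' : β' < β) :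
    ∃ R : ℝ, 2 ≤ R ∧ ∀ 𝒟 : ℕ → ℕ → Set (Set X), SparseObstacles 𝒟 R μ.support →
      ∃ (ν : Measure X) (γ : ℝ), IsProbabilityMeasure ν ∧ β' < γ ∧ PowerLaw ν γ ∧
        ν.support ⊆ μ.support ∧ ∀ n k, ∀ D ∈ 𝒟 n k, Disjoint D ν.support := by
  obtain ⟨hβ, b₁, b₂, hb₁, hb₂, hb⟩ := hμ
  let c := b₁ / (b₂ * 24 ^ β)
  have hc : 0 < c := by positivity
  -- replacing `β'` by `max β' 0` makes `R ^ β₀ ≥ 1`, hence `M ≥ 2`, even if `β'` is negative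
  let β₀ := max β' 0
  have hβ₀ : β₀ < β := max_lt hβ' hβ
  -- a node has at least `c * R ^ β` separated children, and `⌊R ^ β₀⌋ + 1` have to be left after
  -- the removal of four of them
  obtain ⟨R, hR, hRc⟩ : ∃ R : ℝ, 8 ≤ R ∧ R ^ β₀ * 7 ≤ c * R ^ β := by
    have h1 := (tendsto_rpow_atTop (sub_pos.2 hβ₀)).eventually (Filter.eventually_ge_atTop (7 / c))
    obtain ⟨R, hR, hR8⟩ := (h1.and (Filter.eventually_ge_atTop 8)).exists
    refine ⟨R, hR8, ?_⟩
    have hR0 : 0 < R := by linarith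
    rw [div_le_iff₀ hc, Real.rpow_sub hR0, div_mul_eq_mul_div, le_div_iff₀ (by positivity)] at hR
    linarith
  have hR0 : 0 < R := by linarith
  have hR2 : 2 ≤ R := by linarith
  refine ⟨R, hR2, fun 𝒟 h𝒟 => ?_⟩
  have hRβ : 1 ≤ R ^ β₀ := Real.one_le_rpow (by linarith) (le_max_right _ _)
  let M := ⌊R ^ β₀⌋₊ + 1
  have hMfl : (⌊R ^ β₀⌋₊ : ℝ) ≤ R ^ β₀ := Nat.floor_le (by positivity)
  have hM : R ^ β₀ < M := by
    simp only [M]; push_cast; exact Nat.lt_floor_add_one _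
  have hM2 : 2 ≤ M := by
    have : 1 < (M : ℝ) := hRβ.trans_lt hM
    exact_mod_cast this
  have hchild : ∀ n, ∀ s : {s : PrunedNode X // s.Admissible 𝒟 R μ.support n},
      ∃ f : Fin M → {s : PrunedNode X // s.Admissible 𝒟 R μ.support (n + 1)},
        (∀ a, dist (f a).1.point s.1.point ≤ treeRadius R n / 2) ∧
        ∀ a b, a ≠ b → 12 * treeRadius R (n + 1) < dist (f a).1.point (f b).1.point := by
    rintro n ⟨s, hs⟩
    have hr := treeRadius_pos hR2 (n + 1)
    have hr0 : treeRadius R n ≤ 1 / 2 := by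
      rw [← treeRadius_zero (R := R)]; exact treeRadius_antitone hR2 (Nat.zero_le n)
    have hrs := treeRadius_eq_mul_succ hR2 n
    obtain ⟨t, htc, htK, htd⟩ := exists_separated_finset hb₂ hb hs.mem
      (a := treeRadius R n / 2) (δ := 12 * treeRadius R (n + 1))
      (by linarith [treeRadius_pos hR2 n]) (by linarith) (by positivity) (by nlinarith) (M + 4) (by
        have h1 : ((M + 4 : ℕ) : ℝ) ≤ c * R ^ β := by
          simp only [M]; push_cast; linarith
        have h2 : (treeRadius R n / 2) ^ β =
            R ^ β / 24 ^ β * (12 * treeRadius R (n + 1)) ^ β := by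
          rw [← Real.div_rpow (by positivity) (by positivity),
            ← Real.mul_rpow (by positivity) (by positivity), hrs]
          congr 1
          ring
        have h3 : c * R ^ β * b₂ = b₁ * (R ^ β / 24 ^ β) := by
          simp only [c]; field_simp
        rw [h2, ← mul_assoc, ← mul_assoc, ← h3]
        gcongr)
    obtain ⟨f, hf1, hf2, hf3⟩ := hs.exists_children hR2 h𝒟 htc.ge htK htd
    exact ⟨fun a => ⟨f a, hf1 a⟩, hf2, hf3⟩
  choose child hnest hsep using hchild
  obtain ⟨x₀, hx₀⟩ := Measure.nonempty_support (IsProbabilityMeasure.ne_zero μ)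
  let root : {s : PrunedNode X // s.Admissible 𝒟 R μ.support 0} :=
    ⟨⟨x₀, fun _ => ∅⟩, hx₀, fun _ _ h => by omega, fun _ h => by omega, by simp [pendingWeight]⟩
  obtain ⟨ν, hν, hνp, hνs⟩ := exists_powerLaw_of_tree hR2 hM2 (fun n s => s.1.point) root child
    hnest hsep
  refine ⟨ν, _, hν, ?_, hνp, ?_, ?_⟩
  · refine (le_max_left β' 0).trans_lt ?_
    rw [lt_div_iff₀ (Real.log_pos (by linarith)), ← Real.log_rpow hR0]
    exact Real.log_lt_log (by positivity) hM
  · intro x hx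
    rw [← Measure.isClosed_support.closure_eq, Metric.mem_closure_iff]
    intro ε hε
    obtain ⟨n, hn⟩ := ((tendsto_treeRadius hR2).eventually (gt_mem_nhds hε)).exists
    obtain ⟨s, hs⟩ := hνs x hx n
    exact ⟨s.1.point, s.2.mem, hs.trans_lt hn⟩
  · intro n k D hD
    refine Set.disjoint_left.2 fun x hxD hx => ?_
    obtain ⟨s, hs⟩ := hνs x hx (n + k + 1)
    exact Set.disjoint_left.1 (s.2.avoids n k le_rfl D hD) hxD hs

/-! ### The Hausdorff dimension of the support of a measure satisfying a power law -/

section Dimension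

variable {X : Type*} [MetricSpace X] [MeasurableSpace X] [BorelSpace X]
  {μ : Measure X} [IsProbabilityMeasure μ] {β : ℝ}

/-- The centres of a maximal separated set give a cover of the support by `O(r ^ (-β))` balls of
radius `2 * r`. -/
lemma exists_finset_cover_support {b₁ : ℝ} (hb₁ : 0 < b₁)
    (hb : ∀ x ∈ μ.support, ∀ r : ℝ, 0 < r → r < 1 →
      ENNReal.ofReal (b₁ * r ^ β) ≤ μ (Metric.closedBall x r))
    {r : ℝ} (hr0 : 0 < r) (hr1 : r < 1) :
    ∃ t : Finset X, t.card * (b₁ * r ^ β) ≤ 1 ∧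
      μ.support ⊆ ⋃ x ∈ t, Metric.closedBall x (2 * r) := by
  classical
  -- a `2 * r`-separated subset of the support of maximal cardinality
  let p : ℕ → Prop := fun m => ∃ t : Finset X, t.card = m ∧ (∀ y ∈ t, y ∈ μ.support) ∧
    ∀ y ∈ t, ∀ z ∈ t, y ≠ z → 2 * r < dist y z
  have hc : 0 < b₁ * r ^ β := by positivity
  have hcard : ∀ t : Finset X, (∀ y ∈ t, y ∈ μ.support) →
      (∀ y ∈ t, ∀ z ∈ t, y ≠ z → 2 * r < dist y z) → t.card * (b₁ * r ^ β) ≤ 1 := by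
    intro t hts htd
    have h1 : ENNReal.ofReal (t.card * (b₁ * r ^ β)) ≤ ENNReal.ofReal 1 :=
      calc ENNReal.ofReal (t.card * (b₁ * r ^ β)) = ∑ y ∈ t, ENNReal.ofReal (b₁ * r ^ β) := by
            rw [Finset.sum_const, nsmul_eq_mul, ENNReal.ofReal_mul (Nat.cast_nonneg _),
              ENNReal.ofReal_natCast]
        _ ≤ ∑ y ∈ t, μ (Metric.closedBall y r) :=
            Finset.sum_le_sum fun y hy => hb y (hts y hy) r hr0 hr1
        _ = μ (⋃ y ∈ t, Metric.closedBall y r) := by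
            refine (measure_biUnion_finset (fun y hy z hz hne => ?_)
              fun _ _ => measurableSet_closedBall).symm
            exact Metric.closedBall_disjoint_closedBall (by linarith [htd y hy z hz hne])
        _ ≤ ENNReal.ofReal 1 := by rw [ENNReal.ofReal_one]; exact prob_le_one
    rwa [ENNReal.ofReal_le_ofReal_iff zero_le_one] at h1
  have hbdd : ∀ m, p m → m ≤ ⌊1 / (b₁ * r ^ β)⌋₊ := by
    rintro m ⟨t, rfl, hts, htd⟩
    exact Nat.le_floor ((le_div_iff₀ hc).2 (hcard t hts htd))
  obtain ⟨t, htc, hts, htd⟩ : p (Nat.findGreatest p ⌊1 / (b₁ * r ^ β)⌋₊) :=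
    Nat.findGreatest_spec (m := 0) (Nat.zero_le _) ⟨∅, by simp⟩
  refine ⟨t, hcard t hts htd, fun x hx => ?_⟩
  by_contra hxt
  simp only [Set.mem_iUnion, Metric.mem_closedBall, exists_prop, not_exists, not_and, not_le]
    at hxt
  have hxn : x ∉ t := fun h => by
    have := hxt x h
    rw [dist_self] at this
    linarith
  have hp : p (t.card + 1) := by
    refine ⟨insert x t, Finset.card_insert_of_notMem hxn, ?_, ?_⟩
    · intro z hz
      rcases Finset.mem_insert.1 hz with rfl | hz
      exacts [hx, hts z hz]
    · intro z hz w hw hne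
      rcases Finset.mem_insert.1 hz with hzy | hz <;> rcases Finset.mem_insert.1 hw with hwy | hw
      · exact absurd (hzy.trans hwy.symm) hne
      · exact hzy ▸ hxt w hw
      · exact hwy ▸ dist_comm x z ▸ hxt z hz
      · exact htd z hz w hw hne
  have := Nat.le_findGreatest (hbdd _ hp) hp
  omega

lemma PowerLaw.dimH_support_le (hμ : PowerLaw μ β) : dimH μ.support ≤ ENNReal.ofReal β := by
  obtain ⟨hβ, b₁, b₂, hb₁, hb₂, hb⟩ := hμ
  let r : ℕ → ℝ := fun n => (1 / 2) ^ (n + 1)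
  have hr0 : ∀ n, 0 < r n := fun n => by positivity
  have hr1 : ∀ n, r n < 1 := fun n => pow_lt_one₀ (by norm_num) (by norm_num) (by omega)
  choose t htc htcov using fun n =>
    exists_finset_cover_support hb₁ (fun x hx r h0 h1 => (hb x hx r h0 h1).1) (hr0 n) (hr1 n)
  have hdiam : ∀ n, ∀ x : X, Metric.ediam (Metric.closedBall x (2 * r n)) ≤
      ENNReal.ofReal (4 * r n) := fun n x => by
    refine Metric.ediam_le fun y hy z hz => ?_
    rw [edist_dist]
    apply ENNReal.ofReal_le_ofReal
    have := dist_triangle_right y z x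
    rw [Metric.mem_closedBall] at hy hz
    linarith
  have hle : μH[β] μ.support ≤ ENNReal.ofReal (4 ^ β / b₁) := by
    refine (Measure.hausdorffMeasure_le_liminf_sum (ι := fun n => t n) (l := Filter.atTop) β
      μ.support (fun n => ENNReal.ofReal (4 * r n)) ?_
      (fun n x => Metric.closedBall (x : X) (2 * r n))
      (Filter.Eventually.of_forall fun n x => hdiam n x)
      (Filter.Eventually.of_forall fun n y hy => ?_)).trans ?_
    · rw [← ENNReal.ofReal_zero]
      refine (ENNReal.continuous_ofReal.tendsto 0).comp ?_
      have h := (tendsto_pow_atTop_nhds_zero_of_lt_one (r := (1 / 2 : ℝ)) (by norm_num)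
        (by norm_num)).comp (Filter.tendsto_add_atTop_nat 1)
      simpa [r] using h.const_mul 4
    · obtain ⟨x, hx, hy⟩ := Set.mem_iUnion₂.1 (htcov n hy)
      exact Set.mem_iUnion.2 ⟨⟨x, hx⟩, hy⟩
    · refine Filter.liminf_le_of_le (by isBoundedDefault) fun b hbl => ?_
      obtain ⟨n, hn⟩ := hbl.exists
      refine hn.trans ?_
      calc ∑ x : t n, Metric.ediam (Metric.closedBall (x : X) (2 * r n)) ^ β
          ≤ ∑ x : t n, ENNReal.ofReal (4 * r n) ^ β :=
            Finset.sum_le_sum fun x _ => ENNReal.rpow_le_rpow (hdiam n x) hβ.le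
        _ = ENNReal.ofReal ((t n).card * (4 * r n) ^ β) := by
            rw [Finset.sum_const, nsmul_eq_mul, ENNReal.ofReal_mul (Nat.cast_nonneg _),
              ENNReal.ofReal_natCast, ENNReal.ofReal_rpow_of_pos (by linarith [hr0 n])]
            simp
        _ ≤ _ := by
            apply ENNReal.ofReal_le_ofReal
            rw [le_div_iff₀ hb₁, Real.mul_rpow (by norm_num) (hr0 n).le]
            have : (0 : ℝ) < 4 ^ β := by positivity
            nlinarith [htc n]
  have h2 : μH[(β.toNNReal : ℝ)] μ.support ≠ ⊤ := by
    rw [Real.coe_toNNReal β hβ.le]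
    exact ne_top_of_le_ne_top ENNReal.ofReal_ne_top hle
  exact dimH_le_of_hausdorffMeasure_ne_top h2

/-- The mass distribution principle for measures satisfying a power law. -/
lemma PowerLaw.le_dimH_support [SecondCountableTopology X] (hμ : PowerLaw μ β) :
    ENNReal.ofReal β ≤ dimH μ.support := by
  obtain ⟨hβ, b₁, b₂, hb₁, hb₂, hb⟩ := hμ
  let c : ENNReal := ENNReal.ofReal b₂
  have hc0 : c ≠ 0 := by simpa [c] using hb₂
  have hct : c ≠ ⊤ := ENNReal.ofReal_ne_top
  have hle : c⁻¹ • μ ≤ μH[β] := by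
    refine Measure.le_hausdorffMeasure β _ (ENNReal.ofReal (1 / 2)) (by simp) fun s hs => ?_
    rw [Measure.smul_apply, smul_eq_mul, ENNReal.inv_mul_le_iff hc0 hct]
    rcases (s ∩ μ.support).eq_empty_or_nonempty with h | ⟨x, hxs, hx⟩
    · have : μ s = 0 := measure_mono_null (fun y hy hy' => (h ▸ ⟨hy, hy'⟩ : y ∈ (∅ : Set X)))
        Measure.measure_compl_support
      rw [this]
      exact zero_le
    · have hst : Metric.ediam s ≠ ⊤ := ne_top_of_le_ne_top ENNReal.ofReal_ne_top hs
      have hsub : ∀ r, Metric.diam s ≤ r → s ⊆ Metric.closedBall x r := fun r hr y hy =>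
        (Metric.dist_le_diam_of_mem' hst hy hxs).trans hr
      have hd : Metric.ediam s = ENNReal.ofReal (Metric.diam s) :=
        (ENNReal.ofReal_toReal hst).symm
      have hd1 : Metric.diam s ≤ 1 / 2 := ENNReal.toReal_le_of_le_ofReal (by norm_num) hs
      have hd0 : 0 ≤ Metric.diam s := Metric.diam_nonneg
      rw [hd, ENNReal.ofReal_rpow_of_nonneg hd0 hβ.le, ← ENNReal.ofReal_mul hb₂.le]
      have hlim : Filter.Tendsto (fun r : ℝ => ENNReal.ofReal (b₂ * r ^ β))
          (nhdsWithin (Metric.diam s) (Set.Ioi (Metric.diam s)))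
          (nhds (ENNReal.ofReal (b₂ * Metric.diam s ^ β))) := by
        refine (ENNReal.continuous_ofReal.tendsto _).comp (Filter.Tendsto.const_mul _ ?_)
        exact ((Real.continuous_rpow_const hβ.le).tendsto _).mono_left nhdsWithin_le_nhds
      refine ge_of_tendsto hlim ?_
      filter_upwards [Ioo_mem_nhdsGT (show Metric.diam s < 1 by linarith)] with r hr
      exact (measure_mono (hsub r hr.1.le)).trans (hb x hx r (hd0.trans_lt hr.1) hr.2).2
  have h1 : μ μ.support = 1 := by
    rw [← prob_compl_eq_zero_iff Measure.isClosed_support.measurableSet]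
    exact Measure.measure_compl_support
  have h2 : μH[(β.toNNReal : ℝ)] μ.support ≠ 0 := by
    intro h0
    have := hle μ.support
    rw [Real.coe_toNNReal β hβ.le] at h0
    rw [h0, Measure.smul_apply, h1, smul_eq_mul, mul_one, nonpos_iff_eq_zero,
      ENNReal.inv_eq_zero] at this
    exact hct this
  exact le_dimH_of_hausdorffMeasure_ne_zero h2

end Dimension

/-! ### Rational obstacles on a vertical line -/

/-- A rational point `(p / q, r / q)` close to the vertical line `x = θ`, with a line
`A x + B y + C = 0` through it, not vertical, whose coefficients are small in terms of `q`. -/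
structure AttachedLine (i j c θ : ℝ) where
  /-- The numerator of the first coordinate. -/
  p : ℤ
  /-- The numerator of the second coordinate. -/
  r : ℤ
  /-- The common denominator. -/
  q : ℕ
  /-- The first coefficient of the line. -/
  A : ℤ
  /-- The second coefficient of the line. -/
  B : ℤ
  /-- The constant coefficient of the line. -/
  C : ℤ
  one_le_q : 1 ≤ q
  one_le_B : 1 ≤ B
  abs_A_le : |(A : ℝ)| ≤ (q : ℝ) ^ i
  B_le : (B : ℝ) ≤ (q : ℝ) ^ j
  mem_line : A * p + B * r + C * q = 0
  close : |(q : ℝ) * θ - p| ≤ c * (q : ℝ) ^ (-i)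

namespace AttachedLine

variable {i j c θ : ℝ} (P P₁ P₂ : AttachedLine i j c θ)

/-- The points of the vertical line `x = θ` which are too close to the rational point. -/
def region : Set (ℝ × ℝ) := {v | v.1 = θ ∧ |(P.q : ℝ) * v.2 - P.r| ≤ c * (P.q : ℝ) ^ (-j)}

/-- The value at `(θ, y)` of the affine form defining the line. -/
def form (y : ℝ) : ℝ := P.A * θ + P.B * y + P.C

/-- The height at which the line crosses the vertical line `x = θ`. -/
noncomputable def crossing : ℝ := -(P.A * θ + P.C) / P.B

lemma q_pos : (0 : ℝ) < P.q := by exact_mod_cast P.one_le_q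

lemma one_le_q_real : (1 : ℝ) ≤ P.q := by exact_mod_cast P.one_le_q

lemma one_le_B_real : (1 : ℝ) ≤ P.B := by exact_mod_cast P.one_le_B

lemma B_pos : (0 : ℝ) < P.B := by linarith [P.one_le_B_real]

/-- If `P₂` has the larger denominator, then the values of the form of `P₁` on the region of `P₂`
are close to the integer obtained by evaluating this form at the numerators of `P₂`. -/
lemma abs_q_mul_form_sub_le (hi : 0 ≤ i) (hj : 0 ≤ j) (hq : P₁.q ≤ P₂.q)
    {v : ℝ × ℝ} (hv : v ∈ P₂.region) :
    |P₂.q * P₁.form v.2 - ((P₁.A * P₂.p + P₁.B * P₂.r + P₁.C * P₂.q : ℤ) : ℝ)| ≤ 2 * c := by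
  have hq' : (P₁.q : ℝ) ≤ P₂.q := by exact_mod_cast hq
  have hq0 := P₂.q_pos
  have h1 : |(P₁.A : ℝ)| * |(P₂.q : ℝ) * θ - P₂.p| ≤ c := by
    calc _ ≤ (P₂.q : ℝ) ^ i * (c * (P₂.q : ℝ) ^ (-i)) := by
          gcongr
          · exact P₁.abs_A_le.trans (Real.rpow_le_rpow P₁.q_pos.le hq' hi)
          · exact P₂.close
      _ = c * ((P₂.q : ℝ) ^ i * (P₂.q : ℝ) ^ (-i)) := by ring
      _ = c := by rw [← Real.rpow_add hq0, add_neg_cancel, Real.rpow_zero, mul_one]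
  have h2 : |(P₁.B : ℝ)| * |(P₂.q : ℝ) * v.2 - P₂.r| ≤ c := by
    calc _ ≤ (P₂.q : ℝ) ^ j * (c * (P₂.q : ℝ) ^ (-j)) := by
          gcongr
          · rw [abs_of_pos P₁.B_pos]
            exact P₁.B_le.trans (Real.rpow_le_rpow P₁.q_pos.le hq' hj)
          · exact hv.2
      _ = c * ((P₂.q : ℝ) ^ j * (P₂.q : ℝ) ^ (-j)) := by ring
      _ = c := by rw [← Real.rpow_add hq0, add_neg_cancel, Real.rpow_zero, mul_one]
  rw [← abs_mul] at h1 h2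
  calc _ = |P₁.A * ((P₂.q : ℝ) * θ - P₂.p) + P₁.B * ((P₂.q : ℝ) * v.2 - P₂.r)| := by
        congr 1; unfold form; push_cast; ring
    _ ≤ _ := abs_add_le _ _
    _ ≤ _ := by linarith

lemma abs_form_le (hi : 0 ≤ i) (hj : 0 ≤ j) (hq : P₁.q ≤ P₂.q)
    (h : P₁.A * P₂.p + P₁.B * P₂.r + P₁.C * P₂.q = 0) {v : ℝ × ℝ} (hv : v ∈ P₂.region) :
    |P₁.form v.2| ≤ 2 * c / P₁.q := by
  have hq' : (P₁.q : ℝ) ≤ P₂.q := by exact_mod_cast hq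
  have h1 := abs_q_mul_form_sub_le P₁ P₂ hi hj hq hv
  rw [h, Int.cast_zero, sub_zero, abs_mul, abs_of_pos P₂.q_pos] at h1
  rw [le_div_iff₀ P₁.q_pos]
  nlinarith [abs_nonneg (P₁.form v.2)]

lemma form_sub (y z : ℝ) : P.form y - P.form z = P.B * (y - z) := by
  unfold form; ring

lemma abs_sub_crossing (y : ℝ) : |y - P.crossing| = |P.form y| / P.B := by
  have hB := P.B_pos
  rw [eq_div_iff hB.ne']
  nth_rewrite 1 [← abs_of_pos hB]
  rw [← abs_mul]
  congr 1
  unfold crossing form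
  field_simp
  ring

/-- The value of the form of `P` at a nearby point, when the ball meets the region of `P`. -/
lemma abs_form_le_of_inter (hi : 0 ≤ i) (hj : 0 ≤ j) {x : ℝ × ℝ} {ρ : ℝ}
    (h : (P.region ∩ Metric.closedBall x ρ).Nonempty) :
    |P.form x.2| ≤ 2 * c / P.q + P.B * ρ := by
  obtain ⟨v, hv, hvx⟩ := h
  have h1 := abs_form_le P P hi hj le_rfl P.mem_line hv
  have h2 : |x.2 - v.2| ≤ ρ := by
    rw [Metric.mem_closedBall, dist_comm, Prod.dist_eq] at hvx
    exact (le_max_right _ _).trans hvx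
  calc |P.form x.2| = |P.form v.2 + P.B * (x.2 - v.2)| := by rw [← form_sub]; congr 1; ring
    _ ≤ |P.form v.2| + P.B * |x.2 - v.2| := by
        rw [← abs_of_pos P.B_pos, ← abs_mul, abs_of_pos P.B_pos]; exact abs_add_le _ _
    _ ≤ _ := by gcongr; exact P.B_pos.le

variable (R g K s : ℝ)

/-- The level of an obstacle for the constant `c = R ^ (-g)`: the integral part of the logarithm
in base `R` of `q * B / c`. The region is contained in an interval of length comparable to
`R ^ (-level)` around the crossing. -/
noncomputable def level : ℕ := ⌊Real.logb R P.q + Real.logb R P.B + g⌋₊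

/-- The depth of an obstacle measures how much smaller `B` is than the bound `q ^ j`: it is `0` if
`q ^ j / B ≤ R ^ K`, and `k + 1` if `q ^ j / B` lies between `R ^ (K + s * k)` (excluded) and
`R ^ (K + s * (k + 1))`. -/
noncomputable def depth : ℕ := ⌈(j * Real.logb R P.q - Real.logb R P.B - K) / s⌉₊

variable {R g K s}

lemma logb_q_nonneg (hR : 2 ≤ R) : 0 ≤ Real.logb R P.q :=
  Real.logb_nonneg (by linarith) P.one_le_q_real

lemma logb_B_nonneg (hR : 2 ≤ R) : 0 ≤ Real.logb R P.B :=
  Real.logb_nonneg (by linarith) P.one_le_B_real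

lemma rpow_logb_q (hR : 2 ≤ R) : R ^ Real.logb R P.q = P.q :=
  Real.rpow_logb (by linarith) (by linarith) P.q_pos

lemma rpow_logb_B (hR : 2 ≤ R) : R ^ Real.logb R P.B = P.B :=
  Real.rpow_logb (by linarith) (by linarith) P.B_pos

lemma abs_A_le_rpow (hR : 2 ≤ R) : |(P.A : ℝ)| ≤ R ^ (Real.logb R P.q * i) := by
  rw [Real.rpow_mul (by linarith), P.rpow_logb_q hR]
  exact P.abs_A_le

lemma logb_B_le (hR : 2 ≤ R) : Real.logb R P.B ≤ j * Real.logb R P.q := by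
  rw [← Real.logb_rpow_eq_mul_logb_of_pos P.q_pos]
  exact Real.logb_le_logb_of_le (by linarith) P.B_pos P.B_le

lemma level_bounds (hR : 2 ≤ R) (hg : 0 ≤ g) :
    (P.level R g : ℝ) ≤ Real.logb R P.q + Real.logb R P.B + g ∧
      Real.logb R P.q + Real.logb R P.B + g < P.level R g + 1 :=
  ⟨Nat.floor_le (by linarith [P.logb_q_nonneg hR, P.logb_B_nonneg hR]), Nat.lt_floor_add_one _⟩

lemma depth_le (hs : 0 < s) :
    j * Real.logb R P.q - Real.logb R P.B ≤ K + s * P.depth R K s := by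
  have := Nat.le_ceil ((j * Real.logb R P.q - Real.logb R P.B - K) / s)
  rw [div_le_iff₀ hs] at this
  unfold depth
  linarith

lemma lt_depth (hs : 0 < s) {k : ℕ} (h : P.depth R K s = k + 1) :
    K + s * k < j * Real.logb R P.q - Real.logb R P.B := by
  have : k < P.depth R K s := by omega
  rw [depth, Nat.lt_ceil, lt_div_iff₀ hs] at this
  linarith

/-- Since `B ≥ 1`, an obstacle of large depth has a large denominator, hence a large level. So each
obstacle is assigned to some `n ≥ 0` with level equal to `n + depth + 1`. -/
lemma depth_lt_level (hR : 2 ≤ R) (hj : j ≤ 1) (hs : 1 ≤ s) (hK : 2 ≤ K) (hg : 1 ≤ g) :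
    P.depth R K s + 1 ≤ P.level R g := by
  have ha := P.logb_q_nonneg hR
  have hb := P.logb_B_nonneg hR
  refine Nat.le_floor ?_
  rcases h : P.depth R K s with _ | k
  · norm_num
    linarith
  · have h1 := P.lt_depth (by linarith) h
    push_cast
    have h2 : (0 : ℝ) ≤ k := Nat.cast_nonneg k
    nlinarith

end AttachedLine

/-- The obstacles for weighted badly approximable vectors on the vertical line `x = θ`: the regions
of the rational points of level `n + k + 1` and depth `k`, for the constant `c = R ^ (-g)`. -/
def lineObstacles (i j θ R g K s : ℝ) (n k : ℕ) : Set (Set (ℝ × ℝ)) :=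
  {D | ∃ P : AttachedLine i j (R ^ (-g)) θ, P.level R g = n + k + 1 ∧ P.depth R K s = k ∧
    D = P.region}

section Existence

/-- Dirichlet's pigeonhole argument: every rational point lies on a line with small
coefficients. -/
lemma exists_line_through {i j : ℝ} (hij : i + j = 1) (p r : ℤ) {q : ℕ} (hq : 1 ≤ q) :
    ∃ A B C : ℤ, (A ≠ 0 ∨ B ≠ 0) ∧ |(A : ℝ)| ≤ (q : ℝ) ^ i ∧ |(B : ℝ)| ≤ (q : ℝ) ^ j ∧
      A * p + B * r + C * q = 0 := by
  have hq0 : (0 : ℝ) < q := by exact_mod_cast hq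
  have : NeZero q := ⟨by omega⟩
  let a := ⌊(q : ℝ) ^ i⌋₊
  let b := ⌊(q : ℝ) ^ j⌋₊
  let f : ℕ × ℕ → ZMod q := fun x => x.1 * p + x.2 * r
  have hcard : (Finset.univ : Finset (ZMod q)).card <
      (Finset.range (a + 1) ×ˢ Finset.range (b + 1)).card := by
    rw [Finset.card_univ, ZMod.card, Finset.card_product, Finset.card_range, Finset.card_range]
    have h1 : (q : ℝ) ^ i < a + 1 := Nat.lt_floor_add_one _
    have h2 : (q : ℝ) ^ j < b + 1 := Nat.lt_floor_add_one _
    have h3 : (q : ℝ) < (a + 1) * (b + 1) := by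
      calc (q : ℝ) = (q : ℝ) ^ i * (q : ℝ) ^ j := by
            rw [← Real.rpow_add hq0, hij, Real.rpow_one]
        _ < _ := by gcongr
    exact_mod_cast h3
  obtain ⟨x, hx, y, hy, hxy, hf⟩ := Finset.exists_ne_map_eq_of_card_lt_of_maps_to hcard
    (f := f) fun _ _ => Finset.mem_univ _
  have hbound : ∀ (m : ℕ) {e : ℝ} {u v : ℕ}, m = ⌊(q : ℝ) ^ e⌋₊ → u < m + 1 → v < m + 1 →
      |(((u : ℤ) - v : ℤ) : ℝ)| ≤ (q : ℝ) ^ e := by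
    intro m e u v hm hu hv
    have h1 : (m : ℝ) ≤ (q : ℝ) ^ e := hm ▸ Nat.floor_le (by positivity)
    have h2 : |((u : ℤ) - v : ℤ)| ≤ m := by rw [abs_le]; omega
    have h3 : |(((u : ℤ) - v : ℤ) : ℝ)| ≤ m := by exact_mod_cast h2
    linarith
  simp only [Finset.mem_product, Finset.mem_range] at hx hy
  have hdvd : (q : ℤ) ∣ ((x.1 : ℤ) - y.1) * p + ((x.2 : ℤ) - y.2) * r := by
    rw [← ZMod.intCast_zmod_eq_zero_iff_dvd]
    simp only [f] at hf
    push_cast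
    linear_combination hf
  obtain ⟨C, hC⟩ := hdvd
  refine ⟨(x.1 : ℤ) - y.1, (x.2 : ℤ) - y.2, -C, ?_, hbound a rfl hx.1 hy.1,
    hbound b rfl hx.2 hy.2, by linear_combination hC⟩
  by_contra! h
  exact hxy (Prod.ext (by omega) (by omega))

/-- A rational point close to the line `x = θ`, with `θ` badly approximable of weight `i`, carries
an attached line: the line found by the pigeonhole argument is not vertical. -/
lemma exists_attachedLine {i j c c₀ θ : ℝ} (hi : 0 < i) (hij : i + j = 1) (hc : c ≤ c₀)
    (hθ : ∀ (p : ℤ) (q : ℕ), 1 ≤ q → c₀ < (q : ℝ) ^ (1 / i) * |(q : ℝ) * θ - (p : ℝ)|)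
    (p r : ℤ) {q : ℕ} (hq : 1 ≤ q) (hclose : |(q : ℝ) * θ - p| ≤ c * (q : ℝ) ^ (-i)) :
    ∃ P : AttachedLine i j c θ, P.p = p ∧ P.r = r ∧ P.q = q := by
  obtain ⟨A, B, C, hAB, hA, hB, hline⟩ := exists_line_through hij p r hq
  have hq0 : (0 : ℝ) < q := by exact_mod_cast hq
  -- a vertical line would give an approximation of `θ` which is too good
  have hB0 : B ≠ 0 := by
    rintro rfl
    have hA0 : A ≠ 0 := by simpa using hAB
    have hm : 1 ≤ A.natAbs := Int.natAbs_pos.2 hA0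
    have hmA : ((A.natAbs : ℕ) : ℝ) = |(A : ℝ)| := by
      rw [← Int.cast_natCast, Int.natCast_natAbs, Int.cast_abs]
    have habs : |(A.natAbs : ℝ) * θ - ((-(A.sign * C) : ℤ) : ℝ)| = |(A : ℝ) * θ + C| := by
      rcases lt_or_gt_of_ne hA0 with h | h
      · rw [hmA, abs_of_neg (show (A : ℝ) < 0 by exact_mod_cast h),
          Int.sign_eq_neg_one_of_neg h, ← abs_neg]
        congr 1; push_cast; ring
      · rw [hmA, abs_of_pos (show (0 : ℝ) < A by exact_mod_cast h), Int.sign_eq_one_of_pos h]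
        congr 1; push_cast; ring
    have h1 := hθ (-(A.sign * C)) A.natAbs hm
    rw [habs, hmA] at h1
    have h2 : |(A : ℝ)| ^ (1 / i) ≤ q := by
      calc |(A : ℝ)| ^ (1 / i) ≤ ((q : ℝ) ^ i) ^ (1 / i) :=
            Real.rpow_le_rpow (abs_nonneg _) hA (by positivity)
        _ = q := by rw [← Real.rpow_mul hq0.le, mul_one_div_cancel hi.ne', Real.rpow_one]
    have h3 : (q : ℝ) * |(A : ℝ) * θ + C| = |(A : ℝ)| * |(q : ℝ) * θ - p| := by
      have hl : (A : ℝ) * p + C * q = 0 := by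
        have := hline
        simp only [zero_mul, add_zero] at this
        exact_mod_cast this
      nth_rewrite 1 [← abs_of_pos hq0]
      rw [← abs_mul, ← abs_mul]
      congr 1
      linear_combination hl
    have hcc : 0 ≤ c := by
      by_contra! h
      have : c * (q : ℝ) ^ (-i) < 0 := mul_neg_of_neg_of_pos h (by positivity)
      linarith [abs_nonneg ((q : ℝ) * θ - p)]
    have h4 : |(A : ℝ)| * |(q : ℝ) * θ - p| ≤ c := by
      calc _ ≤ (q : ℝ) ^ i * (c * (q : ℝ) ^ (-i)) := by gcongr
        _ = c * ((q : ℝ) ^ i * (q : ℝ) ^ (-i)) := by ring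
        _ = c := by rw [← Real.rpow_add hq0, add_neg_cancel, Real.rpow_zero, mul_one]
    have h5 : |(A : ℝ)| ^ (1 / i) * |(A : ℝ) * θ + C| ≤ q * |(A : ℝ) * θ + C| := by gcongr
    linarith
  rcases lt_or_gt_of_ne hB0 with h | h
  · exact ⟨⟨p, r, q, -A, -B, -C, hq, by omega, by push_cast; rwa [abs_neg],
      by push_cast; exact (neg_le_abs _).trans hB, by linear_combination -hline, hclose⟩,
      rfl, rfl, rfl⟩
  · exact ⟨⟨p, r, q, A, B, C, hq, h, hA, (le_abs_self _).trans hB, hline, hclose⟩, rfl, rfl, rfl⟩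

end Existence

/-! ### Sparseness of the obstacles given by rational points -/

section Powers

variable {R : ℝ}

lemma treeRadius_eq_rpow (hR : 2 ≤ R) (n : ℕ) : treeRadius R n = R ^ (-(n : ℝ)) / 2 := by
  rw [treeRadius, Real.rpow_neg (by linarith), Real.rpow_natCast, inv_pow]

lemma rpow_add_rpow_le (hR : 2 ≤ R) {a b c : ℝ} (ha : a + 1 ≤ c) (hb : b + 1 ≤ c) :
    R ^ a + R ^ b ≤ R ^ c := by
  have h1 : R ^ c = R ^ (c - 1) * R := by
    rw [← Real.rpow_add_one (by linarith), sub_add_cancel]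
  have h2 : R ^ a ≤ R ^ (c - 1) := Real.rpow_le_rpow_of_exponent_le (by linarith) (by linarith)
  have h3 : R ^ b ≤ R ^ (c - 1) := Real.rpow_le_rpow_of_exponent_le (by linarith) (by linarith)
  have h4 : (0 : ℝ) < R ^ (c - 1) := Real.rpow_pos_of_pos (by linarith) _
  nlinarith

lemma two_mul_rpow_le (hR : 2 ≤ R) {a c : ℝ} (ha : a + 1 ≤ c) : 2 * R ^ a ≤ R ^ c := by
  linarith [rpow_add_rpow_le hR ha ha]

lemma mul_le_rpow (hR : 2 ≤ R) {x y a b c : ℝ} (hx : x ≤ R ^ a) (hy0 : 0 ≤ y) (hy : y ≤ R ^ b)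
    (h : a + b ≤ c) : x * y ≤ R ^ c := by
  have hRa : (0 : ℝ) < R ^ a := Real.rpow_pos_of_pos (by linarith) _
  calc x * y ≤ R ^ a * R ^ b := mul_le_mul hx hy hy0 hRa.le
    _ = R ^ (a + b) := (Real.rpow_add (by linarith) _ _).symm
    _ ≤ R ^ c := Real.rpow_le_rpow_of_exponent_le (by linarith) h

lemma int_eq_zero_of_abs_lt_one {m : ℤ} (h : |(m : ℝ)| < 1) : m = 0 := by
  rw [← Int.abs_lt_one_iff]
  exact_mod_cast h

/-- A combination `u * y - v * x` of small numbers is small. -/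
lemma abs_mul_sub_mul_le (hR : 2 ≤ R) {u v x y a b c : ℝ} (hu : |u| ≤ R ^ a) (hv : |v| ≤ R ^ a)
    (hx : |x| ≤ R ^ b) (hy : |y| ≤ R ^ b) (h : a + b + 1 ≤ c) : |u * y - v * x| ≤ R ^ c := by
  have h1 : |u| * |y| ≤ R ^ (a + b) := mul_le_rpow hR hu (abs_nonneg _) hy le_rfl
  have h2 : |v| * |x| ≤ R ^ (a + b) := mul_le_rpow hR hv (abs_nonneg _) hx le_rfl
  calc |u * y - v * x| ≤ |u * y| + |v * x| := abs_sub _ _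
    _ = |u| * |y| + |v| * |x| := by rw [abs_mul, abs_mul]
    _ ≤ R ^ (a + b) + R ^ (a + b) := add_le_add h1 h2
    _ ≤ R ^ c := rpow_add_rpow_le hR h h

/-- In exponential coordinates, the rational point obtained as the intersection of two lines of
depth `k + 1`, with logarithmic denominator `a₀`, is close to the vertical line and has small
level. -/
lemma intersection_exponents {i j s K k g n a₀ a₁ b₁ : ℝ} (hi : 0 < i) (hj : 0 < j)
    (hij : i + j = 1) (hs : s * j = 1) (hK : K * j = 3 * s + 10) (hs1 : 1 ≤ s)
    (hK' : 3 * s + 10 ≤ K) (hk : 0 ≤ k) (ha : a₀ ≤ a₁ * i + s + b₁ + 3)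
    (h1 : K + s * k < j * a₁ - b₁)
    (h2 : a₁ + b₁ + g < n + (k + 1) + 1 + 1) :
    b₁ - a₁ + k + 6 - g ≤ -g - i * a₀ ∧ a₁ * i - a₁ + s + k + 6 - g ≤ -g - j * a₀ ∧
      a₀ + j * a₀ + g ≤ n := by
  obtain rfl : i = 1 - j := by linarith
  have hsk : k ≤ s * k := by nlinarith
  have ha' : a₀ ≤ a₁ + s + 3 - (K + s * k) := by linarith
  have hia : (1 - j) * a₀ ≤ (1 - j) * a₁ := mul_le_mul_of_nonneg_left (by linarith) hi.le
  have hja : j * a₀ ≤ j * a₁ + s + 3 - (3 * s + 10) - k := by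
    have h4 := mul_le_mul_of_nonneg_left ha' hj.le
    have h5 : j * (a₁ + s + 3 - (K + s * k)) =
        j * a₁ + s * j + 3 * j - K * j - s * j * k := by ring
    rw [h5, hs, hK] at h4
    linarith
  exact ⟨by linarith, by linarith, by linarith⟩

end Powers

namespace AttachedLine

variable {i j θ R g K s : ℝ}

/-- Obstacles on the line of `P₁` whose denominator is at least that of `P₁` lie near the crossing
of this line. -/
lemma region_subset (hi : 0 ≤ i) (hj : 0 ≤ j) (hR : 2 ≤ R) (hg : 0 ≤ g)
    (P₁ P₂ : AttachedLine i j (R ^ (-g)) θ) (hq : P₁.q ≤ P₂.q)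
    (h : P₁.A * P₂.p + P₁.B * P₂.r + P₁.C * P₂.q = 0) :
    P₂.region ⊆ Metric.closedBall (θ, P₁.crossing) (4 * treeRadius R (P₁.level R g)) := by
  intro v hv
  have h1 := abs_form_le P₁ P₂ hi hj hq h hv
  rw [Metric.mem_closedBall, Prod.dist_eq, max_le_iff]
  refine ⟨?_, ?_⟩
  · rw [hv.1, dist_self]
    linarith [treeRadius_pos hR (P₁.level R g)]
  · rw [Real.dist_eq]
    simp only
    rw [abs_sub_crossing, div_le_iff₀ P₁.B_pos]
    refine h1.trans ?_
    rw [div_le_iff₀ P₁.q_pos, treeRadius_eq_rpow hR, ← P₁.rpow_logb_B hR, ← P₁.rpow_logb_q hR]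
    have h2 := (P₁.level_bounds hR hg).1
    have h3 : R ^ (-g) ≤ R ^ (-(P₁.level R g : ℝ)) * R ^ Real.logb R P₁.B *
        R ^ Real.logb R P₁.q := by
      rw [← Real.rpow_add (by linarith), ← Real.rpow_add (by linarith)]
      exact Real.rpow_le_rpow_of_exponent_le (by linarith) (by linarith)
    linarith

/-- Two obstacles of the same level and of depth `0` which meet the same ball: the one with the
larger denominator lies on the line attached to the other one. -/
lemma mem_line_of_depth_eq_zero (hi : 0 ≤ i) (hj : 0 ≤ j) (hs : 0 < s) (hR : 2 ≤ R)
    (hK : 0 ≤ K) (hg : K + 5 < g) {n : ℕ} {x : ℝ × ℝ} {P₁ P₂ : AttachedLine i j (R ^ (-g)) θ}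
    (hq : P₁.q ≤ P₂.q) (hl₁ : P₁.level R g = n + 1) (hl₂ : P₂.level R g = n + 1)
    (hd₂ : P₂.depth R K s = 0)
    (hx₁ : (P₁.region ∩ Metric.closedBall x (treeRadius R n)).Nonempty)
    (hx₂ : (P₂.region ∩ Metric.closedBall x (treeRadius R n)).Nonempty) :
    P₁.A * P₂.p + P₁.B * P₂.r + P₁.C * P₂.q = 0 := by
  have hR0 : 0 < R := by linarith
  obtain ⟨v, hv, hvx⟩ := hx₂
  have hq' : (P₁.q : ℝ) ≤ P₂.q := by exact_mod_cast hq
  have hinter : (P₁.region ∩ Metric.closedBall v (2 * treeRadius R n)).Nonempty := by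
    obtain ⟨w, hw, hwx⟩ := hx₁
    refine ⟨w, hw, ?_⟩
    rw [Metric.mem_closedBall] at *
    linarith [dist_triangle_right w v x]
  have h1 := P₁.abs_form_le_of_inter hi hj hinter
  have h2 := abs_q_mul_form_sub_le P₁ P₂ hi hj hq hv
  obtain ⟨hb1, hb2⟩ := P₁.level_bounds hR (by linarith : 0 ≤ g)
  obtain ⟨hb3, hb4⟩ := P₂.level_bounds hR (by linarith : 0 ≤ g)
  have hd := P₂.depth_le (R := R) (K := K) hs
  have hB1 := P₁.logb_B_le hR
  rw [hd₂, Nat.cast_zero, mul_zero, add_zero] at hd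
  rw [hl₁] at hb1 hb2
  rw [hl₂] at hb3 hb4
  have hlog : Real.logb R P₁.q ≤ Real.logb R P₂.q :=
    Real.logb_le_logb_of_le (by linarith) P₁.q_pos hq'
  push_cast at hb1 hb2 hb3 hb4
  -- the denominators are comparable
  have hcomp : Real.logb R P₂.q ≤ Real.logb R P₁.q + K + 1 := by nlinarith
  apply int_eq_zero_of_abs_lt_one
  have h3 : P₂.q * |P₁.form v.2| ≤ R ^ (K + 4 - g) := by
    calc P₂.q * |P₁.form v.2|
        ≤ P₂.q * (2 * R ^ (-g) / P₁.q + P₁.B * (2 * treeRadius R n)) := by gcongr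
      _ = 2 * R ^ (Real.logb R P₂.q + -g - Real.logb R P₁.q) +
          R ^ (Real.logb R P₂.q + Real.logb R P₁.B + -(n : ℝ)) := by
        rw [Real.rpow_sub hR0, Real.rpow_add hR0, Real.rpow_add hR0, Real.rpow_add hR0,
          rpow_logb_q _ hR, rpow_logb_q _ hR, rpow_logb_B _ hR, treeRadius_eq_rpow hR]
        ring
      _ ≤ R ^ (K + 3 - g) + R ^ (K + 3 - g) := by
        gcongr
        · exact two_mul_rpow_le hR (by linarith)
        · linarith
        · linarith
      _ ≤ R ^ (K + 4 - g) := rpow_add_rpow_le hR (by linarith) (by linarith)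
  have h4 : |((P₁.A * P₂.p + P₁.B * P₂.r + P₁.C * P₂.q : ℤ) : ℝ)| ≤
      P₂.q * |P₁.form v.2| + 2 * R ^ (-g) := by
    rw [abs_sub_comm] at h2
    have := abs_add_le (P₂.q * P₁.form v.2)
      (((P₁.A * P₂.p + P₁.B * P₂.r + P₁.C * P₂.q : ℤ) : ℝ) - P₂.q * P₁.form v.2)
    rw [add_sub_cancel, abs_mul, abs_of_pos P₂.q_pos] at this
    linarith
  calc _ ≤ R ^ (K + 4 - g) + R ^ (1 - g) := by
        linarith [two_mul_rpow_le hR (a := -g) (c := 1 - g) (by linarith)]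
    _ ≤ R ^ (K + 5 - g) := rpow_add_rpow_le hR (by linarith) (by linarith)
    _ < 1 := Real.rpow_lt_one_of_one_lt_of_neg (by linarith) (by linarith)

/-- The value at the centre of a ball of level `n` of the form attached to an obstacle of level
`n + k + 2` which meets this ball. -/
lemma abs_form_le_rpow (hi : 0 ≤ i) (hj : 0 ≤ j) (hR : 2 ≤ R) (hg : 0 ≤ g)
    (P : AttachedLine i j (R ^ (-g)) θ) {n k : ℕ} {a : ℝ} (ha : a ≤ Real.logb R P.q)
    (hl : P.level R g = n + (k + 1) + 1) {x : ℝ × ℝ}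
    (hx : (P.region ∩ Metric.closedBall x (treeRadius R n)).Nonempty) :
    |P.form x.2| ≤ R ^ (k + 4 - g - a) := by
  have hR0 : 0 < R := by linarith
  have hk0 : (0 : ℝ) ≤ k := Nat.cast_nonneg k
  have h2 := (P.level_bounds hR hg).2
  rw [hl] at h2
  push_cast at h2
  calc |P.form x.2| ≤ 2 * R ^ (-g) / P.q + P.B * treeRadius R n :=
        P.abs_form_le_of_inter hi hj hx
    _ = 2 * R ^ (-g - Real.logb R P.q) + R ^ (Real.logb R P.B + -(n : ℝ)) / 2 := by
      rw [Real.rpow_sub hR0, Real.rpow_add hR0, rpow_logb_q _ hR, rpow_logb_B _ hR,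
        treeRadius_eq_rpow hR]
      ring
    _ ≤ R ^ (k + 3 - g - a) + R ^ (k + 3 - g - a) := by
      have h4 : R ^ (Real.logb R P.B + -(n : ℝ)) ≤ R ^ (k + 3 - g - a) :=
        Real.rpow_le_rpow_of_exponent_le (by linarith) (by linarith)
      have h5 : (0 : ℝ) < R ^ (Real.logb R P.B + -(n : ℝ)) := Real.rpow_pos_of_pos hR0 _
      have h6 := two_mul_rpow_le hR (a := -g - Real.logb R P.q)
        (c := k + 3 - g - a) (by linarith)
      linarith
    _ ≤ _ := rpow_add_rpow_le hR (by linarith) (by linarith)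

/-- The ball of level `n` around `x` meets an obstacle of level at most `n` as soon as the region of
some rational point close to the vertical line contains `x` and its denominator `q` satisfies
`q ^ (1 + j) ≤ R ^ (n - g)`, because `B ≤ q ^ j`. -/
lemma not_avoidsUpTo_of_close {c₀ : ℝ} (hi : 0 < i) (hj : j ≤ 1) (hij : i + j = 1) (hR : 2 ≤ R)
    (hs : 1 ≤ s) (hK : 2 ≤ K) (hg : 1 ≤ g) (hc : R ^ (-g) ≤ c₀)
    (hθ : ∀ (p : ℤ) (q : ℕ), 1 ≤ q → c₀ < (q : ℝ) ^ (1 / i) * |(q : ℝ) * θ - (p : ℝ)|)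
    {n : ℕ} {x : ℝ × ℝ} (hxθ : x.1 = θ) {q : ℕ} (hq : 1 ≤ q) {p r : ℤ}
    (hp : |(q : ℝ) * θ - p| ≤ R ^ (-g - i * Real.logb R q))
    (hr : |(q : ℝ) * x.2 - r| ≤ R ^ (-g - j * Real.logb R q))
    (hn : Real.logb R q + j * Real.logb R q + g ≤ n) :
    ¬ AvoidsUpTo (lineObstacles i j θ R g K s) R n x := by
  intro hx
  have hR0 : 0 < R := by linarith
  have hqpos : (0 : ℝ) < q := by exact_mod_cast hq
  have hpow : ∀ e : ℝ, R ^ (-g - e * Real.logb R q) = R ^ (-g) * (q : ℝ) ^ (-e) := by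
    intro e
    nth_rewrite 2 [← Real.rpow_logb hR0 (by linarith) hqpos]
    rw [← Real.rpow_mul hR0.le, ← Real.rpow_add hR0]
    congr 1
    ring
  rw [hpow] at hp hr
  obtain ⟨P₀, -, hP2, hP3⟩ := exists_attachedLine hi hij hc hθ p r hq hp
  have hxP : x ∈ P₀.region := ⟨hxθ, by rw [hP3, hP2]; exact hr⟩
  have hdl := P₀.depth_lt_level hR hj hs hK hg
  have hlev : P₀.level R g ≤ n := by
    have h1 := (P₀.level_bounds hR (by linarith : 0 ≤ g)).1
    have h2 := P₀.logb_B_le hR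
    rw [hP3] at h1 h2
    have h3 : (P₀.level R g : ℝ) ≤ n := by linarith
    exact_mod_cast h3
  exact Set.disjoint_left.1 (hx (P₀.level R g - (P₀.depth R K s + 1)) (P₀.depth R K s)
    (by omega) P₀.region ⟨P₀, by omega, rfl, rfl⟩) hxP
    (Metric.mem_closedBall_self (treeRadius_pos hR n).le)

/-- Two obstacles of the same level and of the same positive depth which meet the same ball: if
this ball avoids all obstacles of lower level, then the attached lines coincide.  Otherwise the
intersection of the two lines would be a rational point of lower level whose region contains the
centre of the ball. -/
lemma crossing_eq_of_depth_pos {c₀ : ℝ} (hi : 0 < i) (hj : 0 < j) (hij : i + j = 1) (hR : 2 ≤ R)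
    (hs : s * j = 1) (hK : K * j = 3 * s + 10) (hg : K + 7 ≤ g) (hc : R ^ (-g) ≤ c₀)
    (hθ : ∀ (p : ℤ) (q : ℕ), 1 ≤ q → c₀ < (q : ℝ) ^ (1 / i) * |(q : ℝ) * θ - (p : ℝ)|)
    {n k : ℕ} {x : ℝ × ℝ} (hxθ : x.1 = θ)
    (hx : AvoidsUpTo (lineObstacles i j θ R g K s) R n x)
    {P₁ P₂ : AttachedLine i j (R ^ (-g)) θ} (hq : P₁.q ≤ P₂.q)
    (hl₁ : P₁.level R g = n + (k + 1) + 1) (hl₂ : P₂.level R g = n + (k + 1) + 1)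
    (hd₁ : P₁.depth R K s = k + 1) (hd₂ : P₂.depth R K s = k + 1)
    (hx₁ : (P₁.region ∩ Metric.closedBall x (treeRadius R n)).Nonempty)
    (hx₂ : (P₂.region ∩ Metric.closedBall x (treeRadius R n)).Nonempty) :
    P₁.crossing = P₂.crossing := by
  have hR0 : 0 < R := by linarith
  have hR1 : 1 ≤ R := by linarith
  have hj1 : j ≤ 1 := by linarith
  have hs1 : 1 ≤ s := by nlinarith
  have hs0 : 0 < s := by linarith
  have hK13 : 3 * s + 10 ≤ K := by
    have : 0 ≤ K := by
      by_contra! h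
      nlinarith
    nlinarith
  have hK2 : 2 ≤ K := by linarith
  have hg1 : 1 ≤ g := by linarith
  have hg0 : 0 ≤ g := by linarith
  have hq' : (P₁.q : ℝ) ≤ P₂.q := by exact_mod_cast hq
  have hlog : Real.logb R P₁.q ≤ Real.logb R P₂.q :=
    Real.logb_le_logb_of_le (by linarith) P₁.q_pos hq'
  have hk0 : (0 : ℝ) ≤ k := Nat.cast_nonneg k
  obtain ⟨hb1, hb2⟩ := P₁.level_bounds hR hg0
  obtain ⟨hb3, hb4⟩ := P₂.level_bounds hR hg0
  have hd1 := P₁.depth_le (R := R) (K := K) hs0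
  have hd2 := P₂.depth_le (R := R) (K := K) hs0
  have hd3 := P₁.lt_depth hs0 hd₁
  have hd4 := P₂.lt_depth hs0 hd₂
  have ha1 := P₁.logb_q_nonneg hR
  have hA1 := P₁.abs_A_le_rpow hR
  have hA2 := P₂.abs_A_le_rpow hR
  have hB1 : |(P₁.B : ℝ)| = R ^ Real.logb R P₁.B := by
    rw [P₁.rpow_logb_B hR, abs_of_pos P₁.B_pos]
  have hB2 : |(P₂.B : ℝ)| = R ^ Real.logb R P₂.B := by
    rw [P₂.rpow_logb_B hR, abs_of_pos P₂.B_pos]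
  rw [hl₁] at hb1 hb2
  rw [hl₂] at hb3 hb4
  rw [hd₁] at hd1
  rw [hd₂] at hd2
  push_cast at hb1 hb2 hb3 hb4 hd1 hd2
  have hV1 := P₁.abs_form_le_rpow hi.le hj.le hR hg0 le_rfl hl₁ hx₁
  have hV2 := P₂.abs_form_le_rpow hi.le hj.le hR hg0 hlog hl₂ hx₂
  set a₁ := Real.logb R P₁.q
  set a₂ := Real.logb R P₂.q
  set b₁ := Real.logb R P₁.B
  set b₂ := Real.logb R P₂.B
  have hcomp : a₂ ≤ a₁ + s + 1 := by
    have := mul_nonneg hj.le (sub_nonneg.2 hlog)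
    linarith
  have hb21 : b₂ ≤ b₁ + 1 := by linarith
  -- the intersection of the two lines, in homogeneous coordinates
  let q₀ : ℤ := P₁.A * P₂.B - P₂.A * P₁.B
  let p₀ : ℤ := P₁.B * P₂.C - P₂.B * P₁.C
  let r₀ : ℤ := P₂.A * P₁.C - P₁.A * P₂.C
  have hp : |(q₀ : ℝ) * θ - p₀| ≤ R ^ (b₁ - a₁ + k + 6 - g) := by
    have h : (q₀ : ℝ) * θ - p₀ = P₂.B * P₁.form x.2 - P₁.B * P₂.form x.2 := by
      simp only [q₀, p₀, form]; push_cast; ring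
    rw [h]
    refine abs_mul_sub_mul_le hR (a := b₁ + 1) ?_ ?_ hV2 hV1 (by linarith)
    · rw [hB2]
      exact Real.rpow_le_rpow_of_exponent_le (by linarith) hb21
    · rw [hB1]
      exact Real.rpow_le_rpow_of_exponent_le (by linarith) (by linarith)
  have hA1' : |(P₁.A : ℝ)| ≤ R ^ (a₁ * i + s + 1) :=
    hA1.trans (Real.rpow_le_rpow_of_exponent_le (by linarith) (by linarith))
  have hA2e : a₂ * i ≤ a₁ * i + s + 1 := by
    have := mul_nonneg hj.le (sub_nonneg.2 hlog)
    have h := mul_le_mul_of_nonneg_right hcomp hi.le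
    have h' : (s + 1) * i ≤ (s + 1) * 1 := by gcongr; linarith
    linarith
  have hA2' : |(P₂.A : ℝ)| ≤ R ^ (a₁ * i + s + 1) :=
    hA2.trans (Real.rpow_le_rpow_of_exponent_le hR1 hA2e)
  have hr : |(q₀ : ℝ) * x.2 - r₀| ≤ R ^ (a₁ * i - a₁ + s + k + 6 - g) := by
    have h : (q₀ : ℝ) * x.2 - r₀ = P₁.A * P₂.form x.2 - P₂.A * P₁.form x.2 := by
      simp only [q₀, r₀, form]; push_cast; ring
    rw [h]
    exact abs_mul_sub_mul_le hR hA1' hA2' hV1 hV2 (by linarith)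
  have hq0 : |(q₀ : ℝ)| ≤ R ^ (a₁ * i + s + b₁ + 3) := by
    simp only [q₀]
    push_cast
    refine abs_mul_sub_mul_le hR (b := b₁ + 1) hA1' hA2' ?_ ?_ (by linarith)
    · rw [hB1]
      exact Real.rpow_le_rpow_of_exponent_le (by linarith) (by linarith)
    · rw [hB2]
      exact Real.rpow_le_rpow_of_exponent_le (by linarith) hb21
  by_cases hq00 : q₀ = 0
  · -- parallel lines
    have hp0 : p₀ = 0 := by
      apply int_eq_zero_of_abs_lt_one
      rw [hq00, Int.cast_zero, zero_mul, zero_sub, abs_neg] at hp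
      refine hp.trans_lt (Real.rpow_lt_one_of_one_lt_of_neg (by linarith) ?_)
      have h1 : j * a₁ ≤ 1 * a₁ := by gcongr
      have h2 : 1 * (k : ℝ) ≤ s * k := by gcongr
      linarith
    have h1 : (P₁.A : ℝ) * P₂.B = P₂.A * P₁.B := by exact_mod_cast sub_eq_zero.1 hq00
    have h2 : (P₁.B : ℝ) * P₂.C = P₂.B * P₁.C := by exact_mod_cast sub_eq_zero.1 hp0
    have h3 := P₁.B_pos
    have h4 := P₂.B_pos
    unfold crossing
    rw [div_eq_div_iff h3.ne' h4.ne']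
    linear_combination (-θ) * h1 + h2
  · exfalso
    have hsign : ∃ (q : ℕ) (p r : ℤ), 1 ≤ q ∧ (q : ℝ) = |(q₀ : ℝ)| ∧
        |(q : ℝ) * θ - p| = |(q₀ : ℝ) * θ - p₀| ∧ |(q : ℝ) * x.2 - r| = |(q₀ : ℝ) * x.2 - r₀| := by
      have hcast : ((q₀.natAbs : ℕ) : ℝ) = |(q₀ : ℝ)| := by
        rw [Nat.cast_natAbs, Int.cast_abs]
      rcases lt_or_gt_of_ne hq00 with h | h
      · have h' : |(q₀ : ℝ)| = -q₀ := abs_of_neg (by exact_mod_cast h)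
        refine ⟨q₀.natAbs, -p₀, -r₀, Int.natAbs_pos.2 hq00, hcast, ?_, ?_⟩ <;>
          rw [hcast, h', ← abs_neg] <;> congr 1 <;> push_cast <;> ring
      · have h' : |(q₀ : ℝ)| = q₀ := abs_of_pos (by exact_mod_cast h)
        exact ⟨q₀.natAbs, p₀, r₀, Int.natAbs_pos.2 hq00, hcast, by rw [hcast, h'],
          by rw [hcast, h']⟩
    obtain ⟨q, p, r, hq1, hqq, hqp, hqr⟩ := hsign
    rw [← hqq] at hq0
    rw [← hqp] at hp
    rw [← hqr] at hr
    have hqpos : (0 : ℝ) < q := by exact_mod_cast hq1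
    set a₀ := Real.logb R q with ha₀
    have hqa : R ^ a₀ = q := Real.rpow_logb hR0 (by linarith) hqpos
    have ha : a₀ ≤ a₁ * i + s + b₁ + 3 := by
      rw [← hqa] at hq0
      exact (Real.rpow_le_rpow_left_iff (by linarith)).1 hq0
    obtain ⟨e1, e2, e3⟩ := intersection_exponents hi hj hij hs hK hs1 hK13 hk0 ha hd3 hb2
    exact not_avoidsUpTo_of_close hi hj1 hij hR hs1 hK2 hg1 hc hθ hxθ hq1
      (hp.trans (Real.rpow_le_rpow_of_exponent_le hR1 e1))
      (hr.trans (Real.rpow_le_rpow_of_exponent_le hR1 e2)) e3 hx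

end AttachedLine

/-- The obstacles for weighted badly approximable vectors are sparse along the vertical line
through a point `θ` which is badly approximable of weight `i`. -/
lemma sparseObstacles_lineObstacles {i j θ R g K s c₀ : ℝ} (hi : 0 < i) (hj : 0 < j)
    (hij : i + j = 1) (hR : 2 ≤ R) (hs : s * j = 1) (hK : K * j = 3 * s + 10) (hg : K + 7 ≤ g)
    (hc : R ^ (-g) ≤ c₀)
    (hθ : ∀ (p : ℤ) (q : ℕ), 1 ≤ q → c₀ < (q : ℝ) ^ (1 / i) * |(q : ℝ) * θ - (p : ℝ)|)
    {E : Set (ℝ × ℝ)} (hE : ∀ v ∈ E, v.1 = θ) :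
    SparseObstacles (lineObstacles i j θ R g K s) R E := by
  classical
  have hs0 : 0 < s := by
    by_contra! h
    nlinarith
  have hK0 : 0 < K := by
    by_contra! h
    nlinarith
  intro n k x hxE hx
  by_cases hex : ∃ q : ℕ, ∃ P : AttachedLine i j (R ^ (-g)) θ, P.q = q ∧
      P.level R g = n + k + 1 ∧ P.depth R K s = k ∧
      (P.region ∩ Metric.closedBall x (treeRadius R n)).Nonempty
  swap
  · refine ⟨x, ?_⟩
    rintro D ⟨P, hl, hd, rfl⟩ hD
    exact absurd ⟨P.q, P, rfl, hl, hd, hD⟩ hex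
  -- the centre is the crossing of the line attached to an obstacle with the least denominator
  obtain ⟨P₁, hq₁, hl₁, hd₁, hx₁⟩ := Nat.find_spec hex
  refine ⟨(θ, P₁.crossing), ?_⟩
  rintro D ⟨P₂, hl₂, hd₂, rfl⟩ hx₂
  have hq : P₁.q ≤ P₂.q := hq₁ ▸ Nat.find_min' hex ⟨P₂, rfl, hl₂, hd₂, hx₂⟩
  rcases k with _ | k
  · have h := AttachedLine.mem_line_of_depth_eq_zero hi.le hj.le hs0 hR hK0.le (by linarith) hq
      hl₁ hl₂ hd₂ hx₁ hx₂
    rw [← hl₁]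
    exact AttachedLine.region_subset hi.le hj.le hR (by linarith) P₁ P₂ hq h
  · rw [AttachedLine.crossing_eq_of_depth_pos hi hj hij hR hs hK hg hc hθ (hE x hxE) hx hq
      hl₁ hl₂ hd₁ hd₂ hx₁ hx₂, ← hl₂]
    exact AttachedLine.region_subset hi.le hj.le hR (by linarith) P₂ P₂ le_rfl P₂.mem_line

/-! ### Badly approximable points on a vertical line -/

/-- The obstacles for badly approximable numbers on the vertical line `x = θ`: neighbourhoods of
the rational heights `p / q`, whose level `n + 1` is given by `q ^ 2 / c`. All of them have
depth `0`. -/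
def heightObstacles (c θ R : ℝ) (n k : ℕ) : Set (Set (ℝ × ℝ)) :=
  {D | k = 0 ∧ ∃ (p : ℤ) (q : ℕ), 1 ≤ q ∧ c * R ^ (n + 1) ≤ (q : ℝ) ^ 2 ∧
    (q : ℝ) ^ 2 < c * R ^ (n + 2) ∧ D = {v | v.1 = θ ∧ (q : ℝ) * |(q : ℝ) * v.2 - p| ≤ c}}

lemma sparseObstacles_heightObstacles {c θ R : ℝ} (hR : 2 ≤ R) (hc : 0 < c) (hcR : c * R ^ 4 ≤ 1)
    {E : Set (ℝ × ℝ)} : SparseObstacles (heightObstacles c θ R) R E := by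
  intro n k x _ _
  have hR0 : 0 < R := by linarith
  by_cases hex : ∃ D ∈ heightObstacles c θ R n k,
      (D ∩ Metric.closedBall x (treeRadius R n)).Nonempty
  swap
  · exact ⟨x, fun D hD hDx => absurd ⟨D, hD, hDx⟩ hex⟩
  obtain ⟨_, ⟨rfl, p₁, q₁, hq₁, hl₁, hu₁, rfl⟩, v₁, hv₁, hvx₁⟩ := hex
  refine ⟨(θ, p₁ / q₁), ?_⟩
  rintro _ ⟨-, p₂, q₂, hq₂, hl₂, hu₂, rfl⟩ ⟨v₂, hv₂, hvx₂⟩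
  have hq₁0 : (0 : ℝ) < q₁ := by exact_mod_cast hq₁
  have hq₂0 : (0 : ℝ) < q₂ := by exact_mod_cast hq₂
  have hdist : |v₁.2 - v₂.2| ≤ 2 * treeRadius R n := by
    have h1 := dist_triangle_right v₁ v₂ x
    rw [Metric.mem_closedBall] at hvx₁ hvx₂
    have h2 : |v₁.2 - v₂.2| ≤ dist v₁ v₂ := by
      rw [Prod.dist_eq]; exact le_max_right _ _
    linarith
  have hrad : 2 * treeRadius R n * R ^ n = 1 := by
    rw [treeRadius, inv_pow]; field_simp
  have hRn : 0 < R ^ n := by positivity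
  have hratio : ∀ {a b : ℝ}, 0 < a → 0 < b → c * R ^ (n + 1) ≤ a ^ 2 → b ^ 2 < c * R ^ (n + 2) →
      b ≤ R * a := by
    intro a b ha hb h1 h2
    refine abs_le_of_sq_le_sq' ?_ (by positivity) |>.2
    calc b ^ 2 ≤ R * (c * R ^ (n + 1)) := h2.le.trans_eq (by ring)
      _ ≤ R * a ^ 2 := by gcongr
      _ ≤ R * (R * a ^ 2) := by nlinarith [mul_pos hR0 (pow_pos ha 2)]
      _ = _ := by ring
  have h12 := hratio hq₁0 hq₂0 hl₁ hu₂
  have h21 := hratio hq₂0 hq₁0 hl₂ hu₁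
  have hprod : (q₁ : ℝ) * q₂ ≤ c * R ^ (n + 2) := by nlinarith [sq_nonneg ((q₁ : ℝ) - q₂)]
  -- two such rational heights are too close to be different
  have hz : p₁ * q₂ - p₂ * q₁ = 0 := by
    apply int_eq_zero_of_abs_lt_one
    have e1 : (q₂ : ℝ) * |(q₁ : ℝ) * v₁.2 - p₁| ≤ R * c := by
      calc _ ≤ R * q₁ * |(q₁ : ℝ) * v₁.2 - p₁| := by gcongr
        _ ≤ R * c := by rw [mul_assoc]; gcongr; exact hv₁.2
    have e2 : (q₁ : ℝ) * |(q₂ : ℝ) * v₂.2 - p₂| ≤ R * c := by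
      calc _ ≤ R * q₂ * |(q₂ : ℝ) * v₂.2 - p₂| := by gcongr
        _ ≤ R * c := by rw [mul_assoc]; gcongr; exact hv₂.2
    have e3 : (q₁ : ℝ) * q₂ * |v₁.2 - v₂.2| ≤ c * R ^ 2 := by
      calc _ ≤ c * R ^ (n + 2) * (2 * treeRadius R n) := by gcongr
        _ = c * R ^ 2 * (2 * treeRadius R n * R ^ n) := by ring
        _ = _ := by rw [hrad, mul_one]
    have e4 : ((p₁ * q₂ - p₂ * q₁ : ℤ) : ℝ) = q₁ * q₂ * (v₁.2 - v₂.2) -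
        q₂ * ((q₁ : ℝ) * v₁.2 - p₁) + q₁ * ((q₂ : ℝ) * v₂.2 - p₂) := by push_cast; ring
    rw [e4]
    calc _ ≤ |(q₁ : ℝ) * q₂ * (v₁.2 - v₂.2)| + |q₂ * ((q₁ : ℝ) * v₁.2 - p₁)| +
          |q₁ * ((q₂ : ℝ) * v₂.2 - p₂)| :=
          (abs_add_le _ _).trans (by gcongr; exact abs_sub _ _)
      _ = (q₁ : ℝ) * q₂ * |v₁.2 - v₂.2| + q₂ * |(q₁ : ℝ) * v₁.2 - p₁| +
          q₁ * |(q₂ : ℝ) * v₂.2 - p₂| := by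
          simp only [abs_mul, Nat.abs_cast]
      _ ≤ c * R ^ 2 + R * c + R * c := by gcongr
      _ < 1 := by
          have h1 : c * R * 2 ≤ c * R * R := by gcongr
          have h2 : c * R ^ 2 * 4 ≤ c * R ^ 2 * R ^ 2 := by gcongr; nlinarith
          have h3 : 0 < c * R ^ 2 := by positivity
          nlinarith
  intro v hv
  rw [Metric.mem_closedBall, Prod.dist_eq, max_le_iff]
  refine ⟨?_, ?_⟩
  · rw [hv.1, dist_self]
    linarith [treeRadius_pos hR (n + 0 + 1)]
  · have hz' : (p₁ : ℝ) * q₂ = p₂ * q₁ := by exact_mod_cast sub_eq_zero.1 hz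
    have heq : (p₁ : ℝ) / q₁ = p₂ / q₂ := by
      rw [div_eq_div_iff hq₁0.ne' hq₂0.ne', hz']
    have hrad' : 2 * treeRadius R (n + 0 + 1) * R ^ (n + 1) = 1 := by
      rw [add_zero, treeRadius, inv_pow]; field_simp
    rw [Real.dist_eq]
    simp only
    rw [heq]
    have e5 : (q₂ : ℝ) ^ 2 * |v.2 - p₂ / q₂| ≤ c := by
      refine le_of_eq_of_le ?_ hv.2
      rw [pow_two, mul_assoc]
      congr 1
      nth_rewrite 1 [← abs_of_pos hq₂0]
      rw [← abs_mul]
      congr 1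
      field_simp
    have e6 : c * R ^ (n + 1) * |v.2 - p₂ / q₂| ≤ c * 1 := by
      rw [mul_one]
      exact (by gcongr : _ ≤ (q₂ : ℝ) ^ 2 * |v.2 - p₂ / q₂|).trans e5
    rw [mul_assoc, mul_le_mul_iff_right₀ hc, ← hrad', mul_comm,
      mul_le_mul_iff_left₀ (by positivity)] at e6
    linarith [treeRadius_pos hR (n + 0 + 1)]

/-- A point of the vertical line which lies in none of the obstacles has a badly approximable
height. -/
lemma mem_badNumbers_of_forall_notMem {c θ R : ℝ} (hR : 2 ≤ R) (hc : 0 < c) (hcR : c * R ^ 4 ≤ 1)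
    {v : ℝ × ℝ} (hv : v.1 = θ) (h : ∀ n k, ∀ D ∈ heightObstacles c θ R n k, v ∉ D) :
    v.2 ∈ badNumbers := by
  refine ⟨c, hc, fun p q hq => ?_⟩
  by_contra! hle
  have hq0 : (1 : ℝ) ≤ q := by exact_mod_cast hq
  have hcR1 : c * R ≤ 1 := by
    refine le_trans ?_ hcR
    gcongr
    exact le_self_pow₀ (by linarith) (by norm_num)
  have hcR0 : 0 < c * R := by positivity
  obtain ⟨n, hn1, hn2⟩ := exists_nat_pow_near (x := (q : ℝ) ^ 2 / (c * R)) (y := R)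
    ((one_le_div hcR0).2 (hcR1.trans (one_le_pow₀ hq0))) (by linarith)
  rw [le_div_iff₀ hcR0] at hn1
  rw [div_lt_iff₀ hcR0] at hn2
  refine h n 0 _ ⟨rfl, p, q, hq, ?_, ?_, rfl⟩ ⟨hv, hle⟩
  · calc c * R ^ (n + 1) = R ^ n * (c * R) := by ring
      _ ≤ _ := hn1
  · calc (q : ℝ) ^ 2 < R ^ (n + 1) * (c * R) := hn2
      _ = _ := by ring

/-- A point of the vertical line which lies in none of the obstacles is a badly approximable
vector. -/
lemma mem_badPair_of_forall_notMem {i j θ R g K s c₀ : ℝ} (hi : 0 < i) (hj : 0 < j)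
    (hij : i + j = 1) (hR : 2 ≤ R) (hs : 1 ≤ s) (hK : 2 ≤ K) (hg : 1 ≤ g) (hc : R ^ (-g) ≤ c₀)
    (hθ : ∀ (p : ℤ) (q : ℕ), 1 ≤ q → c₀ < (q : ℝ) ^ (1 / i) * |(q : ℝ) * θ - (p : ℝ)|)
    {v : ℝ × ℝ} (hv : v.1 = θ) (h : ∀ n k, ∀ D ∈ lineObstacles i j θ R g K s n k, v ∉ D) :
    v ∈ badPair i j := by
  rw [badPair, if_neg hj.ne', if_neg hi.ne']
  have hc0 : 0 < R ^ (-g) := Real.rpow_pos_of_pos (by linarith) _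
  refine ⟨min ((R ^ (-g)) ^ (1 / i)) ((R ^ (-g)) ^ (1 / j)), by positivity, fun p₁ p₂ q hq => ?_⟩
  by_contra! hle
  have hq0 : (0 : ℝ) < q := by exact_mod_cast hq
  have key : ∀ {e z : ℝ}, 0 < e → (q : ℝ) * |z| ^ (1 / e) ≤ (R ^ (-g)) ^ (1 / e) →
      |z| ≤ R ^ (-g) * (q : ℝ) ^ (-e) := by
    intro e z he h1
    have h2 := Real.rpow_le_rpow (by positivity) h1 he.le
    rw [Real.mul_rpow hq0.le (by positivity), ← Real.rpow_mul (abs_nonneg _),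
      ← Real.rpow_mul hc0.le, one_div_mul_cancel he.ne', Real.rpow_one, Real.rpow_one] at h2
    rw [Real.rpow_neg hq0.le, ← div_eq_mul_inv, le_div_iff₀ (by positivity)]
    linarith
  have h1 := key hi ((le_max_left _ _).trans (hle.trans (min_le_left _ _)))
  have h2 := key hj ((le_max_right _ _).trans (hle.trans (min_le_right _ _)))
  rw [hv] at h1
  obtain ⟨P, -, hr, hPq⟩ := exists_attachedLine hi hij hc hθ p₁ p₂ hq h1
  have hdl := P.depth_lt_level hR (by linarith) hs hK hg
  refine h (P.level R g - (P.depth R K s + 1)) (P.depth R K s) _ ⟨P, by omega, rfl, rfl⟩ ⟨hv, ?_⟩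
  rw [hPq, hr]
  exact h2

/-- The existence of the measures `ν` for any `μ` supported on the whole vertical line through
`θ`. -/
theorem exists_powerLaw_support_subset_badPair (i j : ℝ) (hi : i ∈ Set.Icc (0 : ℝ) 1)
    (hj : j ∈ Set.Icc (0 : ℝ) 1) (hij : i + j = 1) (θ : ℝ) (hθ : θ ∈ badWeight i)
    (μ : Measure (ℝ × ℝ)) [IsProbabilityMeasure μ] (hμθ : ∀ v ∈ μ.support, v.1 = θ)
    (β : ℝ) (hμ : PowerLaw μ β) (β' : ℝ) (hβ' : β' < β) :
    ∃ (ν : Measure (ℝ × ℝ)) (γ : ℝ), IsProbabilityMeasure ν ∧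
      β' < γ ∧ PowerLaw ν γ ∧ ν.support ⊆ badPair i j ∩ μ.support := by
  rcases hj.1.eq_or_lt with rfl | hj0
  · obtain rfl : i = 1 := by linarith
    refine ⟨μ, β, inferInstance, hβ', hμ, fun v hv => ⟨?_, hv⟩⟩
    rw [badPair, if_pos rfl]
    rw [badWeight, if_neg one_ne_zero] at hθ
    refine ⟨?_, trivial⟩
    rw [hμθ v hv]
    simpa [badNumbers] using hθ
  obtain ⟨R, hR, hex⟩ := exists_powerLaw_avoiding hμ hβ'
  have hR0 : 0 < R := by linarith
  rcases hi.1.eq_or_lt with rfl | hi0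
  · obtain rfl : j = 1 := by linarith
    have hc : 0 < (R ^ 4)⁻¹ := by positivity
    have hcR : (R ^ 4)⁻¹ * R ^ 4 ≤ 1 := (inv_mul_cancel₀ (by positivity)).le
    obtain ⟨ν, γ, hν, hγ, hνp, hνs, hνD⟩ := hex _
      (sparseObstacles_heightObstacles (θ := θ) hR hc hcR)
    refine ⟨ν, γ, hν, hγ, hνp, fun v hv => ⟨?_, hνs hv⟩⟩
    rw [badPair, if_neg one_ne_zero, if_pos rfl]
    exact ⟨trivial, mem_badNumbers_of_forall_notMem hR hc hcR (hμθ v (hνs hv))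
      fun n k D hD hvD => Set.disjoint_left.1 (hνD n k D hD) hvD hv⟩
  · rw [badWeight, if_neg hi0.ne'] at hθ
    obtain ⟨c₀, hc₀, hθ⟩ := hθ
    -- each unit of depth divides the denominator of the intersection of two lines by `R ^ s`, hence
    -- its `j`-th power by `R`, which makes up for the balls being larger by a factor `R`; the
    -- constant `K` absorbs the fixed powers of `R` lost in the comparisons
    let s := 1 / j
    let K := (3 * s + 10) / j
    have hs : s * j = 1 := one_div_mul_cancel hj0.ne'
    have hs1 : 1 ≤ s := (one_le_div hj0).2 hj.2
    have hK : K * j = 3 * s + 10 := div_mul_cancel₀ _ hj0.ne'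
    have hK2 : 2 ≤ K := by
      rw [le_div_iff₀ hj0]
      linarith [hj.2]
    let g := max (K + 7) (-Real.logb R c₀)
    have hg : K + 7 ≤ g := le_max_left _ _
    have hc : R ^ (-g) ≤ c₀ := by
      rw [← Real.le_logb_iff_rpow_le (by linarith) hc₀]
      linarith [le_max_right (K + 7) (-Real.logb R c₀)]
    obtain ⟨ν, γ, hν, hγ, hνp, hνs, hνD⟩ := hex _
      (sparseObstacles_lineObstacles hi0 hj0 hij hR hs hK hg hc hθ hμθ)
    exact ⟨ν, γ, hν, hγ, hνp, fun v hv => ⟨mem_badPair_of_forall_notMem hi0 hj0 hij hR hs1 hK2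
      (by linarith) hc hθ (hμθ v (hνs hv))
        fun n k D hD hvD => Set.disjoint_left.1 (hνD n k D hD) hvD hv, hνs hv⟩⟩

theorem theorem6 (i j : ℝ) (hi : i ∈ Set.Icc (0 : ℝ) 1) (hj : j ∈ Set.Icc (0 : ℝ) 1)
    (hij : i + j = 1) (θ : ℝ) (hθ : θ ∈ badWeight i)
    (C : Set (ℝ × ℝ)) (hC : C ⊆ verticalSegment θ)
    (μ : Measure (ℝ × ℝ)) [IsProbabilityMeasure μ] (hμC : μ.support = C)
    (β : ℝ) (hμ : PowerLaw μ β) :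
    (∀ β' : ℝ, β' < β → ∃ (ν : Measure (ℝ × ℝ)) (γ : ℝ), IsProbabilityMeasure ν ∧
      β' < γ ∧ PowerLaw ν γ ∧ ν.support ⊆ badPair i j ∩ C) ∧
    dimH (badPair i j ∩ C) = ENNReal.ofReal β := by
  subst hμC
  have hmain := exists_powerLaw_support_subset_badPair i j hi hj hij θ hθ μ
    (fun v hv => (hC hv).1) β hμ
  refine ⟨hmain, le_antisymm ((dimH_mono Set.inter_subset_right).trans hμ.dimH_support_le) ?_⟩
  refine le_of_forall_lt fun a ha => ?_
  obtain ⟨b, hb, hbβ⟩ := exists_between ha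
  have hbt : b ≠ ⊤ := (hbβ.trans_le le_top).ne
  obtain ⟨ν, γ, hν, hγ, hνp, hνs⟩ := hmain b.toReal (by
    rwa [← ENNReal.ofReal_lt_ofReal_iff hμ.1, ENNReal.ofReal_toReal hbt])
  calc a < b := hb
    _ = ENNReal.ofReal b.toReal := (ENNReal.ofReal_toReal hbt).symm
    _ ≤ ENNReal.ofReal γ := ENNReal.ofReal_le_ofReal hγ.le
    _ ≤ dimH ν.support := hνp.le_dimH_support
    _ ≤ _ := dimH_mono hνs
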